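/- Notation. $\Omega=\{0,1\}^{\mathbb N}$; for a finite binary word $x$, $x\Omega$ is the set of sequences beginning with $x$; $\mathcal M(\Omega)$ is the set of Borel probability measures on $\Omega$, and $P(x)=P(x\Omega)$. Basic open sets of $\Omega$ are the sets $x\Omega$; those of $\mathcal M(\Omega)$ are given by finitely many conditions $u<P(y)<v$ with $y$ a word and $u,v\in\mathbb Q$; those of a product of two of these spaces are products of basic open sets. A function $f$ on $\Omega\times\mathcal M(\Omega)$ or on $\Omega\times\Omega$ with values in $[0,\infty]$ is lower semicomputable if, uniformly in $r\in\mathbb Q$, the set $\{f>r\}$ is the union of a computably enumerable family of basic open sets. A uniform test is a lower semicomputable $t\colon\Omega\times\mathcal M(\Omega)\to[0,\infty]$ with $\int t(\omega,P)\,dP(\omega)\le 1$ for every $P$. A representation is a map $\pi\mapsto R_\pi$ from $\Omega$ onto $\mathcal M(\Omega)$ that is computable, i.e. the preimage of a basic open set is the union of a family of sets $x\Omega$ enumerable uniformly in that basic open set. An r-test for $R$ is a lower semicomputable $u\colon\Omega\times\Omega\to[0,\infty]$ with $\int u(\omega,\pi)\,dR_\pi(\omega)\le1$ for every $\pi$.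 A test (of either kind) is universal if it dominates, up to a constant factor, every test of the same kind. Let $\mathbf t(\omega,P)$ be a universal uniform test; $\omega$ is called uniformly random for $P$ if $\mathbf t(\omega,P)<\infty$. Theorem (Day--Miller). (1) For all $\omega\in\Omega$ and $P\in\mathcal M(\Omega)$: $\omega$ is uniformly random for $P$ if and only if there is an oracle $\pi\in\Omega$ such that $P$ is computable with oracle $\pi$ (given a word $y$ and a rational $\varepsilon>0$, an algorithm with oracle $\pi$ finds a rational $\varepsilon$-approximation to $P(y)$) and $\omega$ is Martin-Löf random with respect to $P$ with oracle $\pi$ (that is, $\omega\notin\bigcap_i U_i$ for every sequence of sets $U_i$ that are unions of families of intervals $x\Omega$ enumerable with oracle $\pi$ uniformly in $i$ and satisfy $P(U_i)\le 2^{-i}$). (2) For every representation $R$ and every universal r-test $\mathbf u(\omega,\pi)$ for $R$ there are constants $c_1,c_2<\infty$ such that for all $\omega\in\Omega$ and $P\in\mathcal M(\Omega)$ $$\mathbf t(\omega,P)\le c_1\inf_{\{\pi\,:\,R_\pi=P\}}\mathbf u(\omega,\pi)\quad\text{and}\quad \inf_{\{\pi\,:\,R_\pi=P\}}\mathbf u(\omega,\pi)\le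 c_2\,\mathbf t(\omega,P).$$ -/

import Mathlib

open MeasureTheory
open scoped ENNReal NNReal

namespace AlgRandomness

/-- The Cantor space `{0,1}^ℕ`, with its product topology and Borel (= product) σ-algebra. -/
abbrev Cantor : Type := ℕ → Bool

/-- The interval `xΩ`: all infinite sequences that begin with the word `x`. -/
def cyl (x : List Bool) : Set Cantor :=
  {ω | ∀ (i : ℕ) (h : i < x.length), ω i = x[i]}

/-- Probability distributions on the Cantor space. -/
abbrev PMeas : Type := ProbabilityMeasure Cantor

/-- The value `P(x) = P(xΩ)` of a measure on a binary word. -/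
noncomputable def wordProb (P : PMeas) (x : List Bool) : ℝ :=
  (P : Measure Cantor).real (cyl x)

/-- Codes of rational numbers as constructive objects. -/
abbrev RatCode : Type := ℕ × ℕ × ℕ

/-- The standard numbering of the rationals: `(a, b, c)` is a code of `(a - b) / (c + 1)`. -/
def ratVal (q : RatCode) : ℚ := ((q.1 : ℚ) - (q.2.1 : ℚ)) / ((q.2.2 : ℚ) + 1)

/-- A code of a basic open set in the space of measures:
a finite list of conditions `(y, u, v)`, each meaning `u < P(y) < v`. -/
abbrev MeasCode : Type := List (List Bool × RatCode × RatCode)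

/-- The basic open set of measures given by a finite list of conditions `u < P(y) < v`. -/
def basicMeas (β : MeasCode) : Set PMeas :=
  {P | ∀ e ∈ β, ((ratVal e.2.1 : ℚ) : ℝ) < wordProb P e.1 ∧
    wordProb P e.1 < ((ratVal e.2.2 : ℚ) : ℝ)}

/-- The comparison `r < s` of a (coded) rational number with an element of `[0, ∞]`;
it is true for all negative `r`. -/
def RatLT (r : RatCode) (s : ℝ≥0∞) : Prop :=
  (((ratVal r : ℚ) : ℝ) : EReal) < (s : EReal)

/-- Lower semicomputable functions of a sequence and a measure: the set `{(ω, P) | r < t(ω, P)}`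
is a union of basic open sets `xΩ × β` that are enumerated by an algorithm, given `r`. -/
def LowerSemicomputableMeas (t : Cantor → PMeas → ℝ≥0∞) : Prop :=
  ∃ W : RatCode × List Bool × MeasCode → Prop, REPred W ∧
    ∀ (r : RatCode) (ω : Cantor) (P : PMeas),
      RatLT r (t ω P) ↔ ∃ (x : List Bool) (β : MeasCode),
        W (r, x, β) ∧ ω ∈ cyl x ∧ P ∈ basicMeas β

/-- Lower semicomputable functions of a pair of sequences. -/
def LowerSemicomputableSeq (u : Cantor → Cantor → ℝ≥0∞) : Prop :=
  ∃ W : RatCode × List Bool × List Bool → Prop, REPred W ∧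
    ∀ (r : RatCode) (ω π : Cantor),
      RatLT r (u ω π) ↔ ∃ x y : List Bool, W (r, x, y) ∧ ω ∈ cyl x ∧ π ∈ cyl y

/-- Uniform tests. -/
def IsUniformTest (t : Cantor → PMeas → ℝ≥0∞) : Prop :=
  LowerSemicomputableMeas t ∧ ∀ P : PMeas, ∫⁻ ω, t ω P ∂(P : Measure Cantor) ≤ 1

/-- Universal uniform tests: maximal up to a constant factor among the uniform tests. -/
def IsUniversalUniformTest (t : Cantor → PMeas → ℝ≥0∞) : Prop :=
  IsUniformTest t ∧ ∀ s : Cantor → PMeas → ℝ≥0∞, IsUniformTest s →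
    ∃ c : ℝ≥0, ∀ (ω : Cantor) (P : PMeas), s ω P ≤ c * t ω P

/-- Computable maps from sequences to measures: preimages of basic open sets
are effectively open, uniformly in the basic open set. -/
def ComputableMap (R : Cantor → PMeas) : Prop :=
  ∃ W : MeasCode × List Bool → Prop, REPred W ∧
    ∀ (β : MeasCode) (π : Cantor), R π ∈ basicMeas β ↔ ∃ x : List Bool, W (β, x) ∧ π ∈ cyl x

/-- A representation of measures by binary sequences: a computable map onto the space
of all measures. -/
def IsRepresentation (R : Cantor → PMeas) : Prop :=
  ComputableMap R ∧ Function.Surjective R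

/-- Tests of randomness with respect to a representation of the measure. -/
def IsRTest (R : Cantor → PMeas) (u : Cantor → Cantor → ℝ≥0∞) : Prop :=
  LowerSemicomputableSeq u ∧ ∀ π : Cantor, ∫⁻ ω, u ω π ∂(R π : Measure Cantor) ≤ 1

/-- Universal r-tests: maximal up to a constant factor among the r-tests. -/
def IsUniversalRTest (R : Cantor → PMeas) (u : Cantor → Cantor → ℝ≥0∞) : Prop :=
  IsRTest R u ∧ ∀ s : Cantor → Cantor → ℝ≥0∞, IsRTest R s →
    ∃ c : ℝ≥0, ∀ ω π : Cantor, s ω π ≤ c * u ω π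

/-- A sequence used as an oracle: the bit with a given number is returned on request. -/
def oracle (A : Cantor) : Set (ℕ →. ℕ) := {fun n => Part.some (A n).toNat}

/-- Enumerable (with an oracle) predicates: domains of partial functions recursive
in the oracle. -/
def REPredIn {α : Type} [Primcodable α] (A : Cantor) (p : α → Prop) : Prop :=
  RecursiveIn (oracle A) (fun a : α => Part.assert (p a) fun _ => Part.some ())

/-- The oracle `A` makes the measure `P` computable: an algorithm with oracle `A`, given a word `y`
and a rational `ε > 0`, finds a rational approximation to `P(y)` with error at most `ε`. -/
def MeasComputableIn (A : Cantor) (P : PMeas) : Prop :=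
  ∃ f : List Bool × RatCode → RatCode, ComputableIn (oracle A) f ∧
    ∀ (y : List Bool) (ε : RatCode), 0 < ratVal ε →
      |wordProb P y - ((ratVal (f (y, ε)) : ℚ) : ℝ)| ≤ ((ratVal ε : ℚ) : ℝ)

/-- Martin-Löf tests with oracle `A` for the measure `P`: the sets `U i` are effectively open
relative to `A`, uniformly in `i`, and `P (U i) ≤ 2⁻ⁱ`. -/
def IsMLTest (A : Cantor) (P : PMeas) (U : ℕ → Set Cantor) : Prop :=
  (∃ W : ℕ × List Bool → Prop, REPredIn A W ∧
    ∀ (i : ℕ) (ω : Cantor), ω ∈ U i ↔ ∃ x : List Bool, W (i, x) ∧ ω ∈ cyl x) ∧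
  ∀ i : ℕ, (P : Measure Cantor) (U i) ≤ (2⁻¹ : ℝ≥0∞) ^ i

/-- Martin-Löf randomness of `ω` with oracle `A` with respect to the measure `P`. -/
def MLRandom (A : Cantor) (P : PMeas) (ω : Cantor) : Prop :=
  ∀ U : ℕ → Set Cantor, IsMLTest A P U → ω ∉ ⋂ i, U i

end AlgRandomness

/-! Effective compactness of Cantor space carries the theorem. If the relation "`A` is not a name of
`P`" is effectively open and a test `u(A, ω, P)` is lower semicomputable, then the infimum of `u`
over the names of `P` exceeds `r` iff, for some `r' > r`, every `A` either fails to be a name of `P`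
or satisfies `u > r'`. A universal quantifier over a compact space preserves effective openness
(`EffOpen.forall_cantor`), so the infimum is lower semicomputable. Its integral is bounded by that
for any single name of `P`. This is `isUniformTest_iInf`.

For part (2), the names of `P` are the `π` with `R π = P`; unequal measures are separated by a
rational on some word, so non-names form an effectively open set. The infimum of an r-test is then a
uniform test, which gives one inequality. Composing a uniform test with `R` gives an r-test, hence
the other.

For part (1), if `A` computes `P`, then the sets `{t > 2 ^ i}` form a Martin-Löf test with oracle
`A` by Markov's inequality, so randomness forces `t` to be finite (`lt_top_of_mlRandom`).
Conversely, a concrete notion of name is used for which every name computes its measure (`IsName`),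
together with a test `oracleDeficiency` that is lower semicomputable in oracle, sequence and measure
jointly and is finite only on Martin-Löf random sequences. It runs every code and accepts a stage
only once its measure is verified to be small, so it is a test for every pair of oracle and measure.
Its infimum over names is a uniform test; where `t` is finite, some name witnesses randomness.

Oracle computations enter the same calculus: enumerability with oracle `A` is effective openness
over the one-point space with basis `oracleB A`. -/

namespace AlgRandomness

open Encodable

/-! ### Enumerable predicates -/

section REPred

variable {α β γ : Type*} [Primcodable α] [Primcodable β] [Primcodable γ]

/-- Predicates that hold when some stage of a primitive recursive check succeeds are enumerable. -/
theorem rePred_of_exists {q : α × ℕ → Prop} (hq : PrimrecPred q) :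
    REPred fun a => ∃ n, q (a, n) := by
  classical
  have h : Partrec fun a : α => Nat.rfind fun n => Part.some (decide (q (a, n))) :=
    Partrec.rfind (hq.decide.to_comp.partrec.to₂)
  refine h.dom_re.of_eq fun a => ?_
  refine Nat.rfind_dom.trans ?_
  simp

theorem rePred_of_primrecPred {p : α → Prop} (hp : PrimrecPred p) : REPred p :=
  hp.computablePred.to_re

/-- An enumerable predicate is the domain of a code. -/
theorem exists_code_of_rePred {p : α → Prop} (hp : REPred p) :
    ∃ c : Nat.Partrec.Code, ∀ a, p a ↔ ∃ n, (c.evaln n (encode a)).isSome := by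
  obtain ⟨c, hc⟩ := Nat.Partrec.Code.exists_code.1 hp
  refine ⟨c, fun a => ?_⟩
  have h1 : p a ↔ (c.eval (encode a)).Dom := by simp [hc, Part.assert]
  rw [h1, Part.dom_iff_mem]
  simp only [Nat.Partrec.Code.evaln_complete, Option.isSome_iff_exists, Option.mem_def]
  exact exists_comm

theorem primrecPred_evaln_isSome :
    PrimrecPred fun p : (ℕ × Nat.Partrec.Code) × ℕ => (p.1.2.evaln p.1.1 p.2).isSome := by
  refine Primrec.primrecPred ?_
  simpa using Primrec.option_isSome.comp Nat.Partrec.Code.primrec_evaln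

/-- Kleene normal form: running a code for a bounded number of steps is primitive recursive. With
the converse `rePred_of_exists`, closure properties reduce to primitive recursive predicates of a
stage. -/
theorem _root_.REPred.exists_primrecPred {p : α → Prop} (hp : REPred p) :
    ∃ q : α × ℕ → Prop, PrimrecPred q ∧ ∀ a, p a ↔ ∃ n, q (a, n) := by
  obtain ⟨c, hc⟩ := exists_code_of_rePred hp
  refine ⟨fun x => (c.evaln x.2 (encode x.1)).isSome, ?_, hc⟩
  exact primrecPred_evaln_isSome.comp
    ((Primrec.snd.pair (Primrec.const c)).pair (Primrec.encode.comp Primrec.fst))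

theorem _root_.REPred.comp {p : β → Prop} (hp : REPred p) {f : α → β} (hf : Computable f) :
    REPred fun a => p (f a) :=
  Partrec.comp hp hf

theorem _root_.REPred.and {p q : α → Prop} (hp : REPred p) (hq : REPred q) :
    REPred fun a => p a ∧ q a := by
  obtain ⟨p', hp', h1⟩ := hp.exists_primrecPred
  obtain ⟨q', hq', h2⟩ := hq.exists_primrecPred
  refine (rePred_of_exists (q := fun x : α × ℕ =>
    p' (x.1, x.2.unpair.1) ∧ q' (x.1, x.2.unpair.2)) ?_).of_eq fun a => ?_
  · have hu := Primrec.unpair.comp (Primrec.snd (α := α) (β := ℕ))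
    exact (hp'.comp (Primrec.fst.pair (Primrec.fst.comp hu))).and
      (hq'.comp (Primrec.fst.pair (Primrec.snd.comp hu)))
  · rw [h1, h2]
    constructor
    · rintro ⟨n, h, h'⟩
      exact ⟨⟨_, h⟩, ⟨_, h'⟩⟩
    · rintro ⟨⟨m, h⟩, ⟨n, h'⟩⟩
      exact ⟨Nat.pair m n, by simpa using ⟨h, h'⟩⟩

theorem _root_.REPred.or {p q : α → Prop} (hp : REPred p) (hq : REPred q) :
    REPred fun a => p a ∨ q a := by
  obtain ⟨p', hp', h1⟩ := hp.exists_primrecPred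
  obtain ⟨q', hq', h2⟩ := hq.exists_primrecPred
  refine (rePred_of_exists (q := fun x : α × ℕ => p' x ∨ q' x) (hp'.or hq')).of_eq fun a => ?_
  rw [h1, h2, exists_or]

theorem _root_.PrimrecPred.exists_decode {q : α × β → Prop} (hq : PrimrecPred q) :
    PrimrecPred fun x : α × ℕ => ∃ b ∈ decode (α := β) x.2, q (x.1, b) := by
  classical
  refine Primrec.primrecPred ?_
  have h : Primrec fun x : α × ℕ =>
      ((decode (α := β) x.2).map fun b => decide (q (x.1, b))).getD false :=
    Primrec.option_getD.comp
      (Primrec.option_map (Primrec.decode.comp Primrec.snd)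
        (hq.decide.comp ((Primrec.fst.comp Primrec.fst).pair Primrec.snd)).to₂)
      (Primrec.const false)
  refine h.of_eq fun x => ?_
  rcases decode (α := β) x.2 with _ | b <;> simp

theorem _root_.REPred.exists {p : α × β → Prop} (hp : REPred p) :
    REPred fun a => ∃ b, p (a, b) := by
  obtain ⟨p', hp', h1⟩ := hp.exists_primrecPred
  have h := _root_.PrimrecPred.exists_decode (α := α) (β := β × ℕ) (q := fun x => p' ((x.1, x.2.1), x.2.2))
    (hp'.comp ((Primrec.fst.pair (Primrec.fst.comp Primrec.snd)).pair
      (Primrec.snd.comp Primrec.snd)))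
  refine (rePred_of_exists h).of_eq fun a => ?_
  simp only [h1]
  constructor
  · rintro ⟨n, ⟨b, m⟩, -, h⟩
    exact ⟨b, m, h⟩
  · rintro ⟨b, m, h⟩
    exact ⟨encode (b, m), (b, m), by simp, h⟩

/-- A finite conjunction is witnessed by a single list that pairs every element with a stage at
which it is confirmed. -/
theorem _root_.REPred.forall_mem_list {p : α × β → Prop} (hp : REPred p) :
    REPred fun x : List β × α => ∀ b ∈ x.1, p (x.2, b) := by
  obtain ⟨p', hp', h1⟩ := hp.exists_primrecPred
  have h2 : PrimrecPred fun y : (List β × α) × List (β × ℕ) =>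
      y.2.map Prod.fst = y.1.1 ∧ ∀ m ∈ y.2, p' ((y.1.2, m.1), m.2) := by
    refine PrimrecPred.and (Primrec.eq.comp (Primrec.list_map Primrec.snd
      (Primrec.fst.comp Primrec.snd).to₂) (Primrec.fst.comp Primrec.fst)) ?_
    have h3 : PrimrecRel fun (m : β × ℕ) (a : α) => p' ((a, m.1), m.2) :=
      hp'.comp ((Primrec.snd.pair (Primrec.fst.comp Primrec.fst)).pair
        (Primrec.snd.comp Primrec.fst))
    exact h3.forall_mem_list.comp Primrec.snd (Primrec.snd.comp Primrec.fst)
  refine (rePred_of_primrecPred h2).exists.of_eq ?_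
  rintro ⟨l, a⟩
  constructor
  · rintro ⟨M, hM, h⟩ b hb
    simp only at hM hb
    rw [← hM, List.mem_map] at hb
    obtain ⟨m, hm, rfl⟩ := hb
    exact (h1 _).2 ⟨m.2, h m hm⟩
  · intro h
    simp only [h1] at h
    choose! f hf using h
    refine ⟨l.map fun b => (b, f b), by simp [Function.comp_def], ?_⟩
    simpa using hf

end REPred

/-! ### Effectively open families and effectively continuous maps -/

section EffOpen

variable {X Y ι κ α β : Type*} [Primcodable ι] [Primcodable κ] [Primcodable α] [Primcodable β]

/-- A family of sets indexed by codes, such that finite intersections of its members are unions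
of members that are enumerable from the list of the intersected sets. -/
def EffBasis (B : ι → Set X) : Prop :=
  ∃ rel : List ι × ι → Prop, REPred rel ∧
    ∀ (l : List ι) (x : X), (∀ j ∈ l, x ∈ B j) ↔ ∃ i, rel (l, i) ∧ x ∈ B i

/-- Families of sets that are, uniformly in the parameter, unions of enumerable families of
members of `B`. -/
def EffOpen (B : ι → Set X) (p : α → X → Prop) : Prop :=
  ∃ V : α × ι → Prop, REPred V ∧ ∀ a x, p a x ↔ ∃ i, V (a, i) ∧ x ∈ B i

variable {B : ι → Set X} {C : κ → Set Y} {p q : α → X → Prop}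

theorem EffOpen.of_iff (hp : EffOpen B p) (h : ∀ a x, q a x ↔ p a x) : EffOpen B q := by
  obtain ⟨V, hV, hV'⟩ := hp
  exact ⟨V, hV, fun a x => (h a x).trans (hV' a x)⟩

theorem effOpen_mem : EffOpen B fun i x => x ∈ B i :=
  ⟨fun z => z.1 = z.2, rePred_of_primrecPred (Primrec.eq.comp Primrec.fst Primrec.snd), by simp⟩

theorem EffOpen.comp (hp : EffOpen B p) {f : β → α} (hf : Computable f) :
    EffOpen B fun b x => p (f b) x := by
  obtain ⟨V, hV, hV'⟩ := hp
  exact ⟨fun z => V (f z.1, z.2), hV.comp ((hf.comp Computable.fst).pair Computable.snd),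
    fun a x => hV' _ _⟩

theorem EffOpen.or (hp : EffOpen B p) (hq : EffOpen B q) :
    EffOpen B fun a x => p a x ∨ q a x := by
  obtain ⟨V, hV, hV'⟩ := hp
  obtain ⟨W, hW, hW'⟩ := hq
  refine ⟨fun z => V z ∨ W z, hV.or hW, fun a x => ?_⟩
  simp only [hV', hW', ← exists_or, or_and_right]

theorem EffOpen.exists {p : α × β → X → Prop} (hp : EffOpen B p) :
    EffOpen B fun a x => ∃ b, p (a, b) x := by
  obtain ⟨V, hV, hV'⟩ := hp
  refine ⟨fun z => ∃ b, V ((z.1, b), z.2), ?_, fun a x => ?_⟩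
  · exact REPred.exists (p := fun z : (α × ι) × β => V ((z.1.1, z.2), z.1.2))
      (hV.comp (((Computable.fst.comp Computable.fst).pair Computable.snd).pair
        (Computable.snd.comp Computable.fst)))
  · simp only [hV']
    constructor
    · rintro ⟨b, i, h, hx⟩
      exact ⟨i, ⟨b, h⟩, hx⟩
    · rintro ⟨i, ⟨b, h⟩, hx⟩
      exact ⟨b, i, h, hx⟩

theorem EffOpen.rePred_and {r : α → Prop} (hr : REPred r) (hp : EffOpen B p) :
    EffOpen B fun a x => r a ∧ p a x := by
  obtain ⟨V, hV, hV'⟩ := hp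
  refine ⟨fun z => r z.1 ∧ V z, (hr.comp Computable.fst).and hV, fun a x => ?_⟩
  simp only [hV', and_assoc, exists_and_left]

/-- A witness is a list that picks a basic set for every element; `EffBasis` then rewrites the
intersection of the chosen sets as an enumerable union. -/
theorem EffOpen.forall_mem_list (hB : EffBasis B) {p : α × β → X → Prop} (hp : EffOpen B p) :
    EffOpen B fun (z : α × List β) x => ∀ b ∈ z.2, p (z.1, b) x := by
  obtain ⟨V, hV, hV'⟩ := hp
  obtain ⟨rel, hrel, hrel'⟩ := hB
  have h1 : REPred fun y : ((α × List β) × ι) × List (β × ι) =>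
      (y.2.map Prod.fst = y.1.1.2 ∧ rel (y.2.map Prod.snd, y.1.2)) ∧
        ∀ m ∈ y.2, V ((y.1.1.1, m.1), m.2) := by
    refine REPred.and (REPred.and (rePred_of_primrecPred (Primrec.eq.comp
      (Primrec.list_map Primrec.snd (Primrec.fst.comp Primrec.snd).to₂)
      (Primrec.snd.comp (Primrec.fst.comp Primrec.fst)))) ?_) ?_
    · exact hrel.comp (Primrec.pair (Primrec.list_map Primrec.snd
        (Primrec.snd.comp Primrec.snd).to₂) (Primrec.snd.comp Primrec.fst)).to_comp
    · have h3 := REPred.forall_mem_list (α := α) (β := β × ι)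
        (p := fun z => V ((z.1, z.2.1), z.2.2))
        (hV.comp ((Primrec.fst.pair (Primrec.fst.comp Primrec.snd)).pair
          (Primrec.snd.comp Primrec.snd)).to_comp)
      exact h3.comp (Primrec.snd.pair (Primrec.fst.comp (Primrec.fst.comp Primrec.fst))).to_comp
  refine ⟨_, h1.exists, ?_⟩
  rintro ⟨a, l⟩ x
  constructor
  · intro h
    simp only [hV'] at h
    have : Nonempty ι := ((hrel' [] x).1 (by simp)).nonempty
    choose! f hf using h
    obtain ⟨i, hi, hx⟩ := (hrel' (l.map f) x).1 (by simpa using fun b hb => (hf b hb).2)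
    refine ⟨i, ⟨l.map fun b => (b, f b), ⟨by simp [Function.comp_def],
      by simpa [Function.comp_def] using hi⟩, ?_⟩, hx⟩
    simpa using fun b hb => (hf b hb).1
  · rintro ⟨i, ⟨M, ⟨h2, h3⟩, h4⟩, hx⟩ b hb
    simp only at h2 hb
    rw [← h2, List.mem_map] at hb
    obtain ⟨m, hm, rfl⟩ := hb
    refine (hV' _ _).2 ⟨m.2, h4 m hm, ?_⟩
    exact (hrel' _ _).2 ⟨i, h3, hx⟩ _ (List.mem_map_of_mem hm)

theorem EffOpen.and (hB : EffBasis B) (hp : EffOpen B p) (hq : EffOpen B q) :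
    EffOpen B fun a x => p a x ∧ q a x := by
  have h : EffOpen B fun (z : α × Bool) x => (z.2 = true ∧ p z.1 x) ∨ (z.2 = false ∧ q z.1 x) :=
    ((hp.comp Computable.fst).rePred_and (rePred_of_primrecPred
      (Primrec.eq.comp Primrec.snd (Primrec.const true)))).or
    ((hq.comp Computable.fst).rePred_and (rePred_of_primrecPred
      (Primrec.eq.comp Primrec.snd (Primrec.const false))))
  refine ((h.forall_mem_list hB).comp
    (Computable.pair Computable.id (Computable.const [true, false]))).of_iff fun a x => ?_
  simp [and_comm]

/-- The intersection over the empty list shows that the whole space is effectively open. -/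
theorem EffOpen.of_rePred (hB : EffBasis B) {r : α → Prop} (hr : REPred r) :
    EffOpen B fun a _ => r a := by
  have h := EffOpen.forall_mem_list hB (effOpen_mem (B := B)|>.comp
    (Computable.snd (α := Unit)))
  refine ((h.comp (Computable.const ((), []))).rePred_and hr).of_iff fun a x => ?_
  simp

/-- Maps for which the preimages of the basic sets are effectively open. -/
def EffCont (B : ι → Set X) (C : κ → Set Y) (f : X → Y) : Prop :=
  EffOpen B fun k x => f x ∈ C k

theorem EffOpen.comap {p : α → Y → Prop} (hp : EffOpen C p) {f : X → Y} (hf : EffCont B C f) :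
    EffOpen B fun a x => p a (f x) := by
  obtain ⟨V, hV, hV'⟩ := hp
  refine (EffOpen.exists (p := fun (z : α × κ) x => V z ∧ f x ∈ C z.2)
    ((hf.comp Computable.snd).rePred_and hV)).of_iff fun a x => hV' _ _

/-- The products of basic sets. -/
def prodB (B : ι → Set X) (C : κ → Set Y) (z : ι × κ) : Set (X × Y) := B z.1 ×ˢ C z.2

theorem EffBasis.prod (hB : EffBasis B) (hC : EffBasis C) : EffBasis (prodB B C) := by
  obtain ⟨r, hr, hr'⟩ := hB
  obtain ⟨s, hs, hs'⟩ := hC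
  refine ⟨fun z => r (z.1.map Prod.fst, z.2.1) ∧ s (z.1.map Prod.snd, z.2.2), ?_, ?_⟩
  · refine REPred.and (hr.comp ?_) (hs.comp ?_)
    · exact (Primrec.pair (Primrec.list_map Primrec.fst (Primrec.fst.comp Primrec.snd).to₂)
        (Primrec.fst.comp Primrec.snd)).to_comp
    · exact (Primrec.pair (Primrec.list_map Primrec.fst (Primrec.snd.comp Primrec.snd).to₂)
        (Primrec.snd.comp Primrec.snd)).to_comp
  · rintro l ⟨x, y⟩
    have h1 := hr' (l.map Prod.fst) x
    have h2 := hs' (l.map Prod.snd) y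
    simp only [List.mem_map, forall_exists_index, and_imp, forall_apply_eq_imp_iff₂] at h1 h2
    simp only [prodB, Set.mem_prod, forall_and]
    rw [h1, h2]
    constructor
    · rintro ⟨⟨i, hi, hx⟩, ⟨k, hk, hy⟩⟩
      exact ⟨(i, k), ⟨hi, hk⟩, hx, hy⟩
    · rintro ⟨⟨i, k⟩, ⟨hi, hk⟩, hx, hy⟩
      exact ⟨⟨i, hi, hx⟩, ⟨k, hk, hy⟩⟩

/-- The preimage of a basic set is a product with the whole second factor, which `EffBasis` covers
by basic sets through the empty list. -/
theorem effCont_fst (hC : EffBasis C) : EffCont (prodB B C) B Prod.fst := by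
  obtain ⟨s, hs, hs'⟩ := hC
  refine ⟨fun z => z.1 = z.2.1 ∧ s ([], z.2.2), (rePred_of_primrecPred (Primrec.eq.comp Primrec.fst
    (Primrec.fst.comp Primrec.snd))).and (hs.comp (Primrec.pair (Primrec.const [])
      (Primrec.snd.comp Primrec.snd)).to_comp), ?_⟩
  rintro i ⟨x, y⟩
  have := hs' [] y
  simp only [List.not_mem_nil, false_implies, implies_true, true_iff] at this
  obtain ⟨k, hk, hy⟩ := this
  constructor
  · exact fun h => ⟨(i, k), ⟨rfl, hk⟩, h, hy⟩
  · rintro ⟨⟨i', k⟩, ⟨h1, -⟩, h, -⟩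
    obtain rfl : i = i' := h1
    exact h

theorem effCont_snd (hB : EffBasis B) : EffCont (prodB B C) C Prod.snd := by
  obtain ⟨s, hs, hs'⟩ := hB
  refine ⟨fun z => z.1 = z.2.2 ∧ s ([], z.2.1), (rePred_of_primrecPred (Primrec.eq.comp Primrec.fst
    (Primrec.snd.comp Primrec.snd))).and (hs.comp (Primrec.pair (Primrec.const [])
      (Primrec.fst.comp Primrec.snd)).to_comp), ?_⟩
  rintro i ⟨x, y⟩
  have := hs' [] x
  simp only [List.not_mem_nil, false_implies, implies_true, true_iff] at this
  obtain ⟨k, hk, hx⟩ := this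
  constructor
  · exact fun h => ⟨(k, i), ⟨rfl, hk⟩, hx, h⟩
  · rintro ⟨⟨k, i'⟩, ⟨h1, -⟩, -, h⟩
    obtain rfl : i = i' := h1
    exact h

theorem EffCont.comp {Z μ : Type*} [Primcodable μ] {D : μ → Set Z} {f : X → Y} {g : Y → Z}
    (hg : EffCont C D g) (hf : EffCont B C f) : EffCont B D fun x => g (f x) :=
  EffOpen.comap hg hf

theorem EffCont.prodMk {Z μ : Type*} [Primcodable μ] {D : μ → Set Z} {f : X → Y} {g : X → Z}
    (hB : EffBasis B) (hf : EffCont B C f) (hg : EffCont B D g) :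
    EffCont B (prodB C D) fun x => (f x, g x) :=
  (EffOpen.and hB (EffOpen.comp hf Computable.fst) (EffOpen.comp hg Computable.snd)).of_iff
    fun _ _ => Iff.rfl

end EffOpen

end AlgRandomness

namespace AlgRandomness

open Encodable

/-! ### Binary words and intervals -/

section Words

/-- The list of the first `n` bits of a sequence. -/
def initSeg (A : Cantor) (n : ℕ) : List Bool := (List.range n).map A

@[simp] theorem length_initSeg (A : Cantor) (n : ℕ) : (initSeg A n).length = n := by
  simp [initSeg]

theorem getElem_initSeg (A : Cantor) (n i : ℕ) (h : i < (initSeg A n).length) :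
    (initSeg A n)[i] = A i := by
  simp [initSeg]

theorem getElem?_initSeg (A : Cantor) {n i : ℕ} (h : i < n) : (initSeg A n)[i]? = some (A i) := by
  rw [List.getElem?_eq_getElem (by simpa using h), getElem_initSeg]

theorem initSeg_succ (A : Cantor) (n : ℕ) : initSeg A (n + 1) = initSeg A n ++ [A n] := by
  simp [initSeg, List.range_succ]

theorem mem_cyl_initSeg (A : Cantor) (n : ℕ) : A ∈ cyl (initSeg A n) :=
  fun i h => (getElem_initSeg A n i h).symm

theorem mem_cyl_iff {A : Cantor} {x : List Bool} : A ∈ cyl x ↔ initSeg A x.length = x := by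
  constructor
  · intro h
    refine List.ext_getElem (by simp) fun i h1 h2 => ?_
    rw [getElem_initSeg, h i h2]
  · intro h
    have := mem_cyl_initSeg A x.length
    rwa [h] at this

theorem mem_cyl_of_isPrefix {A : Cantor} {x y : List Bool} (h : x <+: y) (hA : A ∈ cyl y) :
    A ∈ cyl x := by
  intro i hi
  rw [hA i (hi.trans_le h.length_le)]
  exact (h.getElem hi).symm

theorem initSeg_isPrefix (A : Cantor) {m n : ℕ} (h : m ≤ n) : initSeg A m <+: initSeg A n := by
  have h1 := mem_cyl_of_isPrefix (List.take_prefix m (initSeg A n)) (mem_cyl_initSeg A n)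
  rw [mem_cyl_iff] at h1
  rw [List.length_take, length_initSeg, min_eq_left h] at h1
  rw [h1]
  exact List.take_prefix _ _

theorem prefix_initSeg_iff {A : Cantor} {x : List Bool} {n : ℕ} :
    x <+: initSeg A n ↔ A ∈ cyl x ∧ x.length ≤ n := by
  constructor
  · intro h
    exact ⟨mem_cyl_of_isPrefix h (mem_cyl_initSeg A n), by simpa using h.length_le⟩
  · rintro ⟨h, hn⟩
    rw [mem_cyl_iff] at h
    rw [← h]
    exact initSeg_isPrefix A hn

theorem prefix_of_mem_cyl {A : Cantor} {x y : List Bool} (hx : A ∈ cyl x) (hy : A ∈ cyl y)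
    (h : x.length ≤ y.length) : x <+: y := by
  rw [mem_cyl_iff] at hy
  rw [← hy]
  exact prefix_initSeg_iff.2 ⟨hx, h⟩

theorem exists_mem_cyl (x : List Bool) : ∃ A : Cantor, A ∈ cyl x :=
  ⟨fun i => x.getD i false, fun i h => by simp [h]⟩

theorem isOpen_cyl (x : List Bool) : IsOpen (cyl x) := by
  have : cyl x = ⋂ i : Fin x.length, (fun A : Cantor => A i) ⁻¹' {x[i]} := by
    ext A
    simp [cyl, Fin.forall_iff]
  rw [this]
  exact isOpen_iInter_of_finite fun i => (isOpen_discrete _).preimage (continuous_apply _)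

theorem measurableSet_cyl (x : List Bool) : MeasurableSet (cyl x) :=
  (isOpen_cyl x).measurableSet

theorem disjoint_cyl {x y : List Bool} (h : x.length = y.length) (hxy : x ≠ y) :
    Disjoint (cyl x) (cyl y) := by
  rw [Set.disjoint_left]
  intro A hx hy
  rw [mem_cyl_iff] at hx hy
  exact hxy (by rw [← hx, h, hy])

/-- All binary words of a given length. -/
def words : ℕ → List (List Bool)
  | 0 => [[]]
  | n + 1 => (words n).flatMap fun w => [false :: w, true :: w]

@[simp] theorem mem_words {n : ℕ} {w : List Bool} : w ∈ words n ↔ w.length = n := by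
  induction n generalizing w with
  | zero => simp [words]
  | succ n ih =>
    rcases w with _ | ⟨b, w⟩
    · simp [words]
    · cases b <;> simp [words, ih]

theorem nodup_words (n : ℕ) : (words n).Nodup := by
  induction n with
  | zero => simp [words]
  | succ n ih =>
    rw [words, List.nodup_flatMap]
    refine ⟨by simp, ih.imp fun {x y} hxy => ?_⟩
    simp [Function.onFun, List.disjoint_left, hxy]

theorem primrec_words : Primrec words := by
  refine (Primrec.nat_rec₁ [[]] (f := fun _ l => l.flatMap fun w => [false :: w, true :: w])
    ?_).of_eq fun n => ?_
  · refine Primrec.list_flatMap Primrec.snd ?_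
    exact Primrec.list_cons.comp (Primrec.list_cons.comp (Primrec.const false) Primrec.snd)
      (Primrec.list_cons.comp (Primrec.list_cons.comp (Primrec.const true) Primrec.snd)
        (Primrec.const []))
  · induction n with
    | zero => rfl
    | succ n ih => simp only [words, ← ih]

theorem primrecRel_isPrefix : PrimrecRel fun x y : List Bool => x <+: y :=
  PrimrecPred.of_eq (Primrec.eq.comp Primrec.fst
    (Primrec.list_take.comp (Primrec.list_length.comp Primrec.fst) Primrec.snd))
    fun _ => List.prefix_iff_eq_take.symm

end Words

/-! ### Effective bases and effective compactness of Cantor space -/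

section Bases

/-- An intersection of intervals may be empty and so need not be an interval; it is always the union
of the intervals of the common extensions. -/
theorem effBasis_cyl : EffBasis cyl := by
  refine ⟨fun z => ∀ y ∈ z.1, y <+: z.2,
    rePred_of_primrecPred primrecRel_isPrefix.forall_mem_list, fun l A => ?_⟩
  constructor
  · intro h
    -- The sum of the lengths serves as a bound on each of them.
    refine ⟨initSeg A (l.map List.length).sum, fun y hy => ?_, mem_cyl_initSeg _ _⟩
    exact prefix_initSeg_iff.2 ⟨h y hy, List.single_le_sum (by simp) _ (List.mem_map_of_mem hy)⟩
  · rintro ⟨x, h, hx⟩ y hy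
    exact mem_cyl_of_isPrefix (h y hy) hx

theorem effBasis_basicMeas : EffBasis basicMeas := by
  refine ⟨fun z => z.2 = z.1.flatten, rePred_of_primrecPred
    (Primrec.eq.comp Primrec.snd (Primrec.list_flatten.comp Primrec.fst)), fun l P => ?_⟩
  simp only [exists_eq_left]
  constructor
  · intro h e he
    obtain ⟨j, hj, he⟩ := List.mem_flatten.1 he
    exact h j hj e he
  · exact fun h j hj e he => h e (List.mem_flatten.2 ⟨j, hj, he⟩)

theorem EffBasis.preimage {X Y κ : Type*} [Primcodable κ] {C : κ → Set Y} (hC : EffBasis C)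
    (f : X → Y) : EffBasis fun k => f ⁻¹' C k := by
  obtain ⟨r, hr, h⟩ := hC
  exact ⟨r, hr, fun l x => h l (f x)⟩

/-- The conditions on an oracle that hold for `A`: effectively open predicates over this basis
are the predicates that are enumerable with the oracle `A`. -/
def oracleB (A : Cantor) (y : List Bool) : Set Unit := (fun _ => A) ⁻¹' cyl y

theorem effBasis_oracleB (A : Cantor) : EffBasis (oracleB A) := effBasis_cyl.preimage _

theorem effCont_oracleB (A : Cantor) : EffCont (oracleB A) cyl fun _ => A := effOpen_mem

/-- An effective tube lemma: by compactness the condition holds for all sequences iff, for some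
length `k`, every word of length `k` is already covered by an enumerated product set that contains
`x` in its second factor. For fixed `k` this is a finite conjunction. -/
theorem EffOpen.forall_cantor {X ι α : Type*} [Primcodable ι] [Primcodable α] {B : ι → Set X}
    (hB : EffBasis B) {p : α → Cantor × X → Prop} (hp : EffOpen (prodB cyl B) p) :
    EffOpen B fun a x => ∀ A, p a (A, x) := by
  obtain ⟨V, hV, hV'⟩ := hp
  have h1 : EffOpen B fun (z : α × List Bool) x =>
      ∃ y i, (V (z.1, (y, i)) ∧ y <+: z.2) ∧ x ∈ B i := by
    have h2 : REPred fun z : ((α × List Bool) × List Bool) × ι =>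
        V (z.1.1.1, (z.1.2, z.2)) ∧ z.1.2 <+: z.1.1.2 := by
      refine REPred.and (hV.comp ?_) (rePred_of_primrecPred ?_)
      · exact (Primrec.pair (Primrec.fst.comp (Primrec.fst.comp Primrec.fst))
          (Primrec.pair (Primrec.snd.comp Primrec.fst) Primrec.snd)).to_comp
      · exact primrecRel_isPrefix.comp (Primrec.snd.comp Primrec.fst)
          (Primrec.snd.comp (Primrec.fst.comp Primrec.fst))
    exact (((effOpen_mem.comp Computable.snd).rePred_and h2).exists).exists
  have h3 := ((h1.forall_mem_list hB).comp (Computable.pair Computable.fst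
    (primrec_words.to_comp.comp Computable.snd))).exists (α := α) (β := ℕ)
  refine h3.of_iff fun a x => ?_
  simp only [mem_words]
  constructor
  · intro h
    simp only [hV', prodB, Set.mem_prod, Prod.exists] at h
    choose f i hfV hf hi using h
    obtain ⟨t, -, ht⟩ := isCompact_univ.elim_nhds_subcover (fun A => cyl (f A))
      fun A _ => (isOpen_cyl _).mem_nhds (hf A)
    -- At this length, any word is at least as long as the prefixes of the finite subcover, so it
    -- extends one of them.
    refine ⟨t.sup fun A => (f A).length, fun z hz => ?_⟩
    obtain ⟨A', hA'⟩ := exists_mem_cyl z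
    have hA := ht (Set.mem_univ A')
    simp only [Set.mem_iUnion] at hA
    obtain ⟨A, hAt, hA⟩ := hA
    refine ⟨f A, i A, ⟨hfV A, prefix_of_mem_cyl hA hA' ?_⟩, hi A⟩
    rw [hz]
    exact Finset.le_sup (f := fun A => (f A).length) hAt
  · rintro ⟨k, hk⟩ A
    obtain ⟨y, i, ⟨h4, h5⟩, hx⟩ := hk (initSeg A k) (by simp)
    exact (hV' _ _).2 ⟨(y, i), h4, mem_cyl_of_isPrefix h5 (mem_cyl_initSeg A k), hx⟩

end Bases

/-! ### Coded rational numbers -/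

section Rat

theorem exists_ratVal (q : ℚ) : ∃ c : RatCode, ratVal c = q := by
  refine ⟨(q.num.toNat, (-q.num).toNat, q.den - 1), ?_⟩
  have h1 : ((q.num.toNat : ℚ) - ((-q.num).toNat : ℚ)) = q.num := by
    exact_mod_cast congrArg (Int.cast (R := ℚ)) (Int.toNat_sub_toNat_neg q.num)
  have h2 : ((q.den - 1 : ℕ) : ℚ) + 1 = q.den := by
    have := q.den_pos
    exact_mod_cast (by omega : q.den - 1 + 1 = q.den)
  simp only [ratVal, h1, h2, Rat.num_div_den]

/-- Denominators are cleared and subtracted terms moved across, leaving only sums and products of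
natural numbers, which are primitive recursive. -/
theorem ratVal_add_lt_iff (a b c : RatCode) :
    ratVal a + ratVal b < ratVal c ↔
      a.1 * (b.2.2 + 1) * (c.2.2 + 1) + b.1 * (a.2.2 + 1) * (c.2.2 + 1)
          + c.2.1 * (a.2.2 + 1) * (b.2.2 + 1) <
        c.1 * (a.2.2 + 1) * (b.2.2 + 1) + a.2.1 * (b.2.2 + 1) * (c.2.2 + 1)
          + b.2.1 * (a.2.2 + 1) * (c.2.2 + 1) := by
  rw [← Nat.cast_lt (α := ℚ)]
  simp only [ratVal]
  rw [div_add_div _ _ (by positivity) (by positivity), div_lt_div_iff₀ (by positivity)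
    (by positivity)]
  push_cast
  constructor <;> intro h <;> linarith

theorem primrecPred_ratVal_add_lt :
    PrimrecPred fun z : RatCode × RatCode × RatCode => ratVal z.1 + ratVal z.2.1 < ratVal z.2.2 := by
  refine PrimrecPred.of_eq ?_ fun z => (ratVal_add_lt_iff z.1 z.2.1 z.2.2).symm
  have hm := Primrec.nat_mul
  have ha := Primrec.nat_add
  have x1 := Primrec.fst (α := RatCode) (β := RatCode × RatCode)
  have x2 := Primrec.fst.comp (Primrec.snd (α := RatCode) (β := RatCode × RatCode))
  have x3 := Primrec.snd.comp (Primrec.snd (α := RatCode) (β := RatCode × RatCode))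
  have n {f : RatCode × RatCode × RatCode → RatCode} (hf : Primrec f) :
    Primrec fun z => (f z).1 := Primrec.fst.comp hf
  have m {f : RatCode × RatCode × RatCode → RatCode} (hf : Primrec f) :
    Primrec fun z => (f z).2.1 := Primrec.fst.comp (Primrec.snd.comp hf)
  have d {f : RatCode × RatCode × RatCode → RatCode} (hf : Primrec f) :
    Primrec fun z => (f z).2.2 + 1 := Primrec.succ.comp (Primrec.snd.comp (Primrec.snd.comp hf))
  have t {f g h : RatCode × RatCode × RatCode → ℕ} (hf : Primrec f) (hg : Primrec g)
    (hh : Primrec h) : Primrec fun z => f z * g z * h z := hm.comp (hm.comp hf hg) hh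
  exact Primrec.nat_lt.comp
    (ha.comp (ha.comp (t (n x1) (d x2) (d x3)) (t (n x2) (d x1) (d x3))) (t (m x3) (d x1) (d x2)))
    (ha.comp (ha.comp (t (n x3) (d x1) (d x2)) (t (m x1) (d x2) (d x3))) (t (m x2) (d x1) (d x3)))

theorem primrecRel_ratVal_lt : PrimrecRel fun a b : RatCode => ratVal a < ratVal b := by
  refine (primrecPred_ratVal_add_lt.comp (Primrec.pair Primrec.fst
    (Primrec.pair (Primrec.const (0, 0, 0)) Primrec.snd))).of_eq fun z => ?_
  simp [ratVal]

theorem RatLT_iff_exists {r : RatCode} {s : ℝ≥0∞} :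
    RatLT r s ↔ ∃ r' : RatCode, ratVal r < ratVal r' ∧ RatLT r' s := by
  simp only [RatLT]
  constructor
  · intro h
    obtain ⟨q, h1, h2⟩ := EReal.lt_iff_exists_rat_btwn.1 h
    obtain ⟨c, rfl⟩ := exists_ratVal q
    exact ⟨c, by exact_mod_cast h1, h2⟩
  · rintro ⟨r', h1, h2⟩
    refine lt_trans ?_ h2
    exact_mod_cast h1

theorem RatLT_nat_iff {n : ℕ} {s : ℝ≥0∞} : RatLT (n, 0, 0) s ↔ (n : ℝ≥0∞) < s := by
  have : (((ratVal (n, 0, 0) : ℚ) : ℝ) : EReal) = ((n : ℝ≥0∞) : EReal) := by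
    rw [← ENNReal.coe_natCast, EReal.coe_nnreal_eq_coe_real]
    simp [ratVal]
  rw [RatLT, this, EReal.coe_ennreal_lt_coe_ennreal_iff]

end Rat

end AlgRandomness

namespace AlgRandomness

open Encodable

/-! ### Oracle computations as effectively open predicates -/

section Oracle

theorem effOpen_bit : EffOpen cyl fun (z : ℕ × Bool) A => A z.1 = z.2 := by
  refine ⟨fun z => z.2[z.1.1]? = some z.1.2, rePred_of_primrecPred (Primrec.eq.comp
    (Primrec.list_getElem?.comp Primrec.snd (Primrec.fst.comp Primrec.fst))
    (Primrec.option_some.comp (Primrec.snd.comp Primrec.fst))), ?_⟩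
  rintro ⟨n, b⟩ A
  constructor
  · intro h
    obtain rfl : A n = b := h
    exact ⟨initSeg A (n + 1), getElem?_initSeg A n.lt_succ_self, mem_cyl_initSeg A _⟩
  · rintro ⟨y, h, hA⟩
    obtain ⟨h1, h2⟩ := List.getElem?_eq_some_iff.1 h
    exact (hA _ h1).trans h2

/-- A value of a recursion is certified by a finite history of intermediate values. Entries past the
end of the list read as `0`, which is harmless because they must satisfy the same step conditions.
-/
theorem mem_natRec_iff (f : Part ℕ) (h : ℕ → ℕ →. ℕ) (n m : ℕ) :
    m ∈ (Nat.rec f (fun y IH => IH.bind (h y)) n : Part ℕ) ↔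
      ∃ l : List ℕ, (l.getD 0 0 ∈ f ∧ l.getD n 0 = m) ∧
        ∀ i ∈ List.range n, l.getD (i + 1) 0 ∈ h i (l.getD i 0) := by
  constructor
  · intro hm
    have key : ∃ s : ℕ → ℕ, (s 0 ∈ f ∧ s n = m) ∧ ∀ i < n, s (i + 1) ∈ h i (s i) := by
      induction n generalizing m with
      | zero => exact ⟨fun _ => m, ⟨hm, rfl⟩, by simp⟩
      | succ n ih =>
        obtain ⟨k, hk, hm⟩ := Part.mem_bind_iff.1 hm
        obtain ⟨s, ⟨h1, h2⟩, h3⟩ := ih k hk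
        refine ⟨fun i => if i ≤ n then s i else m, ⟨by simpa using h1, by simp⟩, fun i hi => ?_⟩
        rcases Nat.lt_succ_iff_lt_or_eq.1 hi with hi | rfl
        · simpa [hi.le, Nat.succ_le_of_lt hi] using h3 i hi
        · simpa [h2] using hm
    obtain ⟨s, ⟨h1, h2⟩, h3⟩ := key
    have hs : ∀ i ≤ n, ((List.range (n + 1)).map s).getD i 0 = s i := by
      intro i hi
      simp [List.getD, List.getElem?_range (Nat.lt_succ_of_le hi)]
    refine ⟨(List.range (n + 1)).map s, ⟨?_, ?_⟩, fun i hi => ?_⟩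
    · rwa [hs 0 n.zero_le]
    · rwa [hs n le_rfl]
    · have hi := List.mem_range.1 hi
      rw [hs i hi.le, hs (i + 1) hi]
      exact h3 i hi
  · rintro ⟨l, ⟨h1, rfl⟩, h3⟩
    induction n with
    | zero => exact h1
    | succ n ih =>
      refine Part.mem_bind_iff.2 ⟨l.getD n 0, ih fun i hi => h3 i ?_, h3 n (by simp)⟩
      exact List.mem_range.2 ((List.mem_range.1 hi).trans n.lt_succ_self)

/-- The use principle: a computation with oracle `A` depends only on finitely many bits of `A`. -/
theorem effOpen_graph_of_natRecursiveIn {A : Cantor} {f : ℕ →. ℕ}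
    (hf : Nat.RecursiveIn (oracle A) f) :
    EffOpen (oracleB A) fun (z : ℕ × ℕ) _ => z.2 ∈ f z.1 := by
  have hB := effBasis_oracleB A
  have total : ∀ {g : ℕ → ℕ}, Primrec g →
      EffOpen (oracleB A) fun (z : ℕ × ℕ) _ => z.2 ∈ (g : ℕ →. ℕ) z.1 := by
    intro g hg
    refine (EffOpen.of_rePred hB (rePred_of_primrecPred
      (Primrec.eq.comp Primrec.snd (hg.comp Primrec.fst)))).of_iff fun z _ => ?_
    simp
  induction hf with
  | zero => exact total (Primrec.const 0)
  | succ => exact total Primrec.succ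
  | left => exact total (Primrec.fst.comp Primrec.unpair)
  | right => exact total (Primrec.snd.comp Primrec.unpair)
  | oracle g hg =>
    obtain rfl : g = _ := hg
    have h := (effOpen_bit.comap (effCont_oracleB A)).comp
      (f := fun z : (ℕ × ℕ) × Bool => (z.1.1, z.2))
      ((Computable.fst.comp Computable.fst).pair Computable.snd)
    have h2 : Primrec Bool.toNat := Primrec.dom_finite _
    refine ((EffOpen.rePred_and (r := fun z : (ℕ × ℕ) × Bool => z.2.toNat = z.1.2)
      (rePred_of_primrecPred (Primrec.eq.comp (h2.comp Primrec.snd)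
        (Primrec.snd.comp Primrec.fst))) h).exists).of_iff fun z _ => ?_
    simp [eq_comm]
  | pair _ _ ihf ihh =>
    have h := (ihf.comp (f := fun z : (ℕ × ℕ) × (ℕ × ℕ) => (z.1.1, z.2.1))
      (Primrec.pair (Primrec.fst.comp Primrec.fst) (Primrec.fst.comp Primrec.snd)).to_comp).and hB
      (ihh.comp (f := fun z : (ℕ × ℕ) × (ℕ × ℕ) => (z.1.1, z.2.2))
      (Primrec.pair (Primrec.fst.comp Primrec.fst) (Primrec.snd.comp Primrec.snd)).to_comp)
    refine ((h.rePred_and (r := fun z : (ℕ × ℕ) × (ℕ × ℕ) => z.1.2 = Nat.pair z.2.1 z.2.2)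
      (rePred_of_primrecPred (Primrec.eq.comp (Primrec.snd.comp Primrec.fst)
        (Primrec₂.natPair.comp (Primrec.fst.comp Primrec.snd)
          (Primrec.snd.comp Primrec.snd))))).exists).of_iff fun z _ => ?_
    simp only [Seq.seq, Part.map_eq_map, Part.mem_bind_iff, Part.mem_map_iff, Prod.exists]
    constructor
    · rintro ⟨_, ⟨a, ha, rfl⟩, b, hb, hz⟩
      exact ⟨a, b, hz.symm, ha, hb⟩
    · rintro ⟨a, b, hz, ha, hb⟩
      exact ⟨_, ⟨a, ha, rfl⟩, b, hb, hz.symm⟩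
  | comp _ _ ihf ihh =>
    have h := (ihh.comp (f := fun z : (ℕ × ℕ) × ℕ => (z.1.1, z.2))
      (Primrec.pair (Primrec.fst.comp Primrec.fst) Primrec.snd).to_comp).and hB
      (ihf.comp (f := fun z : (ℕ × ℕ) × ℕ => (z.2, z.1.2))
      (Primrec.pair Primrec.snd (Primrec.snd.comp Primrec.fst)).to_comp)
    refine h.exists.of_iff fun z _ => ?_
    exact Part.mem_bind_iff
  | @prec f h _ _ ihf ihh =>
    have hget {γ : Type} [Primcodable γ] {l : γ → List ℕ} {i : γ → ℕ} (hl : Primrec l)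
        (hi : Primrec i) : Primrec fun x => (l x).getD (i x) 0 :=
      (Primrec.list_getD 0).comp hl hi
    have x1 := Primrec.fst.comp (Primrec.fst (α := ℕ × ℕ) (β := List ℕ))
    have x2 := Primrec.snd.comp (Primrec.fst (α := ℕ × ℕ) (β := List ℕ))
    have xl := Primrec.snd (α := ℕ × ℕ) (β := List ℕ)
    have h1 := (ihf.comp (f := fun z : (ℕ × ℕ) × List ℕ => (z.1.1.unpair.1, z.2.getD 0 0))
      (Primrec.pair (Primrec.fst.comp (Primrec.unpair.comp x1))
        (hget xl (Primrec.const 0))).to_comp)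
    have h2 := h1.rePred_and (r := fun z : (ℕ × ℕ) × List ℕ => z.2.getD z.1.1.unpair.2 0 = z.1.2)
      (rePred_of_primrecPred (Primrec.eq.comp
        (hget xl (Primrec.snd.comp (Primrec.unpair.comp x1))) x2))
    have yi := Primrec.snd (α := (ℕ × ℕ) × List ℕ) (β := ℕ)
    have yl := xl.comp (Primrec.fst (α := (ℕ × ℕ) × List ℕ) (β := ℕ))
    have h3 := (ihh.comp (f := fun z : ((ℕ × ℕ) × List ℕ) × ℕ =>
        (Nat.pair z.1.1.1.unpair.1 (Nat.pair z.2 (z.1.2.getD z.2 0)), z.1.2.getD (z.2 + 1) 0))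
      (Primrec.pair (Primrec₂.natPair.comp
        (Primrec.fst.comp (Primrec.unpair.comp (x1.comp Primrec.fst)))
        (Primrec₂.natPair.comp yi (hget yl yi))) (hget yl (Primrec.succ.comp yi))).to_comp)
    have h4 := (h3.forall_mem_list hB).comp (f := fun z : (ℕ × ℕ) × List ℕ => (z, List.range z.1.1.unpair.2))
      (Primrec.pair Primrec.id (Primrec.list_range.comp
        (Primrec.snd.comp (Primrec.unpair.comp x1)))).to_comp
    refine ((h2.and hB h4).exists).of_iff fun z _ => ?_
    refine (mem_natRec_iff (f z.1.unpair.1) (fun y i => h (Nat.pair z.1.unpair.1 (Nat.pair y i)))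
      z.1.unpair.2 z.2).trans ?_
    simp only [and_comm]
  | @rfind f _ ihf =>
    have x1 := Primrec.fst (α := ℕ) (β := ℕ)
    have h1 := ihf.comp (f := fun z : ℕ × ℕ => (Nat.pair z.1 z.2, 0))
      (Primrec.pair (Primrec₂.natPair.comp Primrec.fst Primrec.snd) (Primrec.const 0)).to_comp
    -- At each argument before the result, a value of the form `k + 1` certifies that the
    -- computation halts there with a nonzero answer.
    have h2 := ihf.comp (f := fun z : ((ℕ × ℕ) × ℕ) × ℕ => (Nat.pair z.1.1.1 z.1.2, z.2 + 1))
      (Primrec.pair (Primrec₂.natPair.comp (Primrec.fst.comp (Primrec.fst.comp Primrec.fst))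
        (Primrec.snd.comp Primrec.fst)) (Primrec.succ.comp Primrec.snd)).to_comp
    have h3 := (h2.exists.forall_mem_list hB).comp (f := fun z : ℕ × ℕ => (z, List.range z.2))
      (Primrec.pair Primrec.id (Primrec.list_range.comp Primrec.snd)).to_comp
    refine (h1.and hB h3).of_iff fun z _ => ?_
    refine Nat.mem_rfind.trans (and_congr ?_ ?_)
    · simp
    · refine ⟨fun h i hi => ?_, fun h i hi => ?_⟩
      · obtain ⟨v, hv, hv'⟩ := (Part.mem_map_iff _).1 (h (List.mem_range.1 hi))
        obtain ⟨k, rfl⟩ := Nat.exists_eq_succ_of_ne_zero (n := v) (by simpa using hv')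
        exact ⟨k, hv⟩
      · obtain ⟨k, hk⟩ := h i (List.mem_range.2 hi)
        exact (Part.mem_map_iff _).2 ⟨k + 1, hk, by simp⟩

variable {α σ : Type} [Primcodable α] [Primcodable σ]

theorem effOpen_graph_of_recursiveIn {A : Cantor} {f : α →. σ} (hf : RecursiveIn (oracle A) f) :
    EffOpen (oracleB A) fun (z : α × σ) _ => z.2 ∈ f z.1 := by
  refine ((effOpen_graph_of_natRecursiveIn hf).comp (f := fun z : α × σ => (encode z.1, encode z.2))
    (Primrec.pair (Primrec.encode.comp Primrec.fst)
      (Primrec.encode.comp Primrec.snd)).to_comp).of_iff fun z _ => ?_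
  simp

/-- A primitive recursion appends one oracle bit at a time. Searches with an oracle can then apply
ordinary primitive recursive checks to initial segments. -/
theorem natRecursiveIn_encode_initSeg (A : Cantor) :
    Nat.RecursiveIn (oracle A) fun n => Part.some (encode (initSeg A n)) := by
  have hstep : Nat.Primrec fun p : ℕ =>
      encode (((decode (α := List Bool) p.unpair.1).getD []) ++ [p.unpair.2.bodd]) := by
    refine Primrec.nat_iff.1 (Primrec.encode.comp (Primrec.list_append.comp
      (Primrec.option_getD.comp (Primrec.decode.comp (Primrec.fst.comp Primrec.unpair))
        (Primrec.const [])) (Primrec.list_cons.comp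
          (Primrec.nat_bodd.comp (Primrec.snd.comp Primrec.unpair)) (Primrec.const []))))
  have hyi : Nat.RecursiveIn (oracle A) fun p => Part.some p.unpair.2.unpair.2 :=
    (Nat.Primrec.recursiveIn (Primrec.nat_iff.1 (Primrec.snd.comp (Primrec.unpair.comp
      (Primrec.snd.comp Primrec.unpair)))))
  have hy : Nat.RecursiveIn (oracle A) fun p => Part.some p.unpair.2.unpair.1 :=
    (Nat.Primrec.recursiveIn (Primrec.nat_iff.1 (Primrec.fst.comp (Primrec.unpair.comp
      (Primrec.snd.comp Primrec.unpair)))))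
  have hbit : Nat.RecursiveIn (oracle A) fun n => Part.some (A n).toNat := .oracle _ rfl
  have h := Nat.RecursiveIn.prec (O := oracle A)
    (Nat.Primrec.recursiveIn (Nat.Primrec.const (encode ([] : List Bool))))
    ((Nat.Primrec.recursiveIn hstep).comp (hyi.pair (hbit.comp hy)))
  have hz : Nat.RecursiveIn (oracle A) fun n => Part.some (Nat.pair 0 n) :=
    Nat.Primrec.recursiveIn (Primrec.nat_iff.1
      (Primrec₂.natPair.comp (Primrec.const 0) Primrec.id))
  refine (h.comp hz).of_eq fun n => ?_
  simp only [Part.bind_eq_bind, Part.bind_some, Nat.unpair_pair]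
  induction n with
  | zero => simp [initSeg]
  | succ n ih =>
    simp only [ih]
    cases hA : A n <;> simp [initSeg_succ, Seq.seq, hA]

/-- Uniformization: if the pairs `(a, s)` with a certain property are enumerable with oracle `A`,
then an algorithm with oracle `A` finds some `s` for every `a` that has one. -/
theorem EffOpen.exists_recursiveIn {A : Cantor} {p : α × σ → Unit → Prop}
    (hp : EffOpen (oracleB A) p) :
    ∃ f : α →. σ, RecursiveIn (oracle A) f ∧ (∀ a, (f a).Dom ↔ ∃ s, p (a, s) ()) ∧
      ∀ a, ∀ s ∈ f a, p (a, s) () := by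
  classical
  obtain ⟨V, hV, hV'⟩ := hp
  obtain ⟨q, hq, hqV⟩ := hV.exists_primrecPred
  -- The search number `k` has two roles: it is the length of the oracle segment consulted, and its
  -- first unpaired component codes a solution, the oracle prefix it uses and a stage.
  let T : ℕ × List Bool → Prop := fun z =>
    ∃ a ∈ decode (α := α) z.1, ∃ t ∈ decode (α := σ × List Bool × ℕ) z.2.length.unpair.1,
      q (((a, t.1), t.2.1), t.2.2) ∧ t.2.1 <+: z.2
  have hT : PrimrecPred T := by
    have h1 : PrimrecPred fun z : (α × List Bool) × (σ × List Bool × ℕ) =>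
        q (((z.1.1, z.2.1), z.2.2.1), z.2.2.2) ∧ z.2.2.1 <+: z.1.2 := by
      have h2 := Primrec.snd (α := α × List Bool) (β := σ × List Bool × ℕ)
      have h3 := Primrec.fst.comp (Primrec.snd.comp h2)
      exact (hq.comp ((((Primrec.fst.comp Primrec.fst).pair (Primrec.fst.comp h2)).pair h3).pair
        (Primrec.snd.comp (Primrec.snd.comp h2)))).and
        (primrecRel_isPrefix.comp h3 (Primrec.snd.comp Primrec.fst))
    have h2 := h1.exists_decode.comp (f := fun z : List Bool × α =>
      ((z.2, z.1), z.1.length.unpair.1)) ((Primrec.snd.pair Primrec.fst).pair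
        (Primrec.fst.comp (Primrec.unpair.comp (Primrec.list_length.comp Primrec.fst))))
    exact h2.exists_decode.comp (Primrec.snd.pair Primrec.fst)
  let out : ℕ → Option σ := fun k => (decode (α := σ × List Bool × ℕ) k.unpair.1).map Prod.fst
  have hout : Primrec out := Primrec.option_map
    (Primrec.decode.comp (Primrec.fst.comp Primrec.unpair)) (Primrec.fst.comp Primrec.snd).to₂
  let F : ℕ →. ℕ := fun n => Nat.rfind fun k => Part.some (decide (T (n, initSeg A k)))
  have hF : Nat.RecursiveIn (oracle A) F := by
    -- Minimization searches for a zero, hence the negation.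
    have h1 : Nat.Primrec fun p : ℕ => (decide ¬ ∃ w ∈ decode (α := List Bool) p.unpair.2,
        T (p.unpair.1, w)).toNat := by
      refine Primrec.nat_iff.1 ((Primrec.dom_finite Bool.toNat).comp (PrimrecPred.decide ?_))
      exact (hT.exists_decode.comp Primrec.unpair).not
    have hl : Nat.RecursiveIn (oracle A) fun p => Part.some p.unpair.1 := .left
    have h2 := Nat.RecursiveIn.rfind ((Nat.Primrec.recursiveIn h1).comp
      (hl.pair ((natRecursiveIn_encode_initSeg A).comp .right)))
    refine h2.of_eq fun n => ?_
    congr 1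
    funext k
    simp [Seq.seq]
  have hFmem : ∀ a k, k ∈ F (encode a) → ∃ s, p (a, s) () ∧ s ∈ out k := by
    intro a k hk
    have h1 := (Nat.mem_rfind.1 hk).1
    obtain ⟨a', ha', t, ht, h2, h3⟩ : T (encode a, initSeg A k) := by simpa using h1
    obtain rfl : a = a' := by simpa using ha'
    simp only [length_initSeg] at ht
    refine ⟨t.1, (hV' _ _).2 ⟨t.2.1, (hqV _).2 ⟨_, h2⟩,
      mem_cyl_of_isPrefix h3 (mem_cyl_initSeg A k)⟩, ?_⟩
    exact Option.mem_map.2 ⟨t, ht, rfl⟩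
  refine ⟨fun a => (F (encode a)).bind fun k => (out k : Part σ), ?_, fun a => ?_, fun a s hs => ?_⟩
  · have h1 : Nat.RecursiveIn (oracle A) fun k => (out k : Part σ).map encode :=
      Nat.Partrec.recursiveIn (Partrec.nat_iff.1
        ((Computable.ofOption hout.to_comp).map (Computable.encode.comp Computable.snd).to₂))
    refine (h1.comp hF).of_eq fun n => ?_
    rcases hn : decode (α := α) n with _ | a
    · have : F n = Part.none := by
        refine Part.eq_none_iff.2 fun k hk => ?_
        obtain ⟨a, ha, -⟩ : T (n, initSeg A k) := by simpa using (Nat.mem_rfind.1 hk).1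
        simp [hn] at ha
      simp [this]
    · have h2 : ∀ w, T (n, w) ↔ T (encode a, w) := fun w => by simp [T, hn]
      have : F n = F (encode a) := by simp only [F, h2]
      simp [this, Part.map_bind]
  · constructor
    · intro h
      obtain ⟨s, hs⟩ := Part.dom_iff_mem.1 h
      obtain ⟨k, hk, -⟩ := Part.mem_bind_iff.1 hs
      obtain ⟨s, hs, -⟩ := hFmem a k hk
      exact ⟨s, hs⟩
    · rintro ⟨s, hs⟩
      obtain ⟨y, hy, hA⟩ := (hV' _ _).1 hs
      obtain ⟨n, hn⟩ := (hqV _).1 hy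
      have hdom : (F (encode a)).Dom := by
        -- Pairing with `y.length` makes the search number at least `y.length`, so the segment
        -- consulted covers the prefix `y`.
        refine Nat.rfind_dom.2 ⟨Nat.pair (encode (s, y, n)) y.length, ?_, by simp⟩
        simp only [Part.mem_some_iff, true_eq_decide_iff]
        refine ⟨a, by simp, (s, y, n), by simp, hn, prefix_initSeg_iff.2 ⟨hA, ?_⟩⟩
        exact Nat.right_le_pair _ _
      obtain ⟨k, hk⟩ := Part.dom_iff_mem.1 hdom
      obtain ⟨s', -, hs'⟩ := hFmem a k hk
      exact Part.dom_iff_mem.2 ⟨s', Part.mem_bind_iff.2 ⟨k, hk, by simpa using hs'⟩⟩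
  · obtain ⟨k, hk, hs⟩ := Part.mem_bind_iff.1 hs
    obtain ⟨s', hs', hs''⟩ := hFmem a k hk
    obtain rfl : s = s' := Option.mem_unique (Part.mem_ofOption.1 hs) hs''
    exact hs'

/-- With the converse `REPredIn.effOpen`, this identifies enumerability in `A` with effective
openness over `oracleB A`. It is the case of uniformization with a trivial output, where only the
domain matters. -/
theorem EffOpen.rePredIn {A : Cantor} {p : α → Unit → Prop} (hp : EffOpen (oracleB A) p) :
    REPredIn A fun a => p a () := by
  obtain ⟨f, hf, hd, -⟩ := (hp.comp (Computable.fst (β := Unit))).exists_recursiveIn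
  refine RecursiveIn.of_eq hf fun a => Part.ext' ?_ fun _ _ => rfl
  rw [hd]
  simp [Part.assert]

theorem REPredIn.effOpen {A : Cantor} {p : α → Prop} (hp : REPredIn A p) :
    EffOpen (oracleB A) fun a _ => p a := by
  refine ((effOpen_graph_of_recursiveIn hp).comp (Computable.pair Computable.id
    (Computable.const ()))).of_iff fun a _ => ?_
  simp

theorem EffOpen.exists_computableIn {A : Cantor} {p : α × σ → Unit → Prop}
    (hp : EffOpen (oracleB A) p) (h : ∀ a, ∃ s, p (a, s) ()) :
    ∃ f : α → σ, ComputableIn (oracle A) f ∧ ∀ a, p (a, f a) () := by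
  obtain ⟨f, hf, hd, hs⟩ := hp.exists_recursiveIn
  refine ⟨fun a => (f a).get ((hd a).2 (h a)), RecursiveIn.of_eq hf fun a => ?_,
    fun a => hs a _ (Part.get_mem _)⟩
  exact (Part.some_get _).symm

end Oracle

end AlgRandomness

namespace AlgRandomness

open Encodable

/-! ### Measures and their values on words -/

section Measures

theorem generateFrom_range_cyl :
    (MeasurableSpace.pi : MeasurableSpace Cantor) = MeasurableSpace.generateFrom (Set.range cyl) := by
  refine le_antisymm ?_ (MeasurableSpace.generateFrom_le ?_)
  · refine iSup_le fun i => ?_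
    rw [← measurable_iff_comap_le]
    refine @measurable_to_countable' Bool Cantor _ _ (MeasurableSpace.generateFrom _) _ fun b => ?_
    have : (fun A : Cantor => A i) ⁻¹' {b} =
        ⋃ w : {w : List Bool // w[i]? = some b}, cyl w.1 := by
      ext A
      simp only [Set.mem_preimage, Set.mem_singleton_iff, Set.mem_iUnion, Subtype.exists,
        exists_prop]
      constructor
      · rintro rfl
        exact ⟨initSeg A (i + 1), getElem?_initSeg A i.lt_succ_self, mem_cyl_initSeg A _⟩
      · rintro ⟨w, h, hA⟩
        obtain ⟨h1, h2⟩ := List.getElem?_eq_some_iff.1 h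
        exact (hA _ h1).trans h2
    rw [this]
    exact MeasurableSet.iUnion fun w => MeasurableSpace.measurableSet_generateFrom ⟨_, rfl⟩
  · rintro _ ⟨x, rfl⟩
    exact measurableSet_cyl x

theorem isPiSystem_range_cyl : IsPiSystem (Set.range cyl) := by
  rintro _ ⟨x, rfl⟩ _ ⟨y, rfl⟩ ⟨A, hx, hy⟩
  rcases le_total x.length y.length with h | h
  · have h := prefix_of_mem_cyl hx hy h
    exact ⟨y, (Set.inter_eq_right.2 fun B hB => mem_cyl_of_isPrefix h hB).symm⟩
  · have h := prefix_of_mem_cyl hy hx h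
    exact ⟨x, (Set.inter_eq_left.2 fun B hB => mem_cyl_of_isPrefix h hB).symm⟩

theorem pMeas_ext {P Q : PMeas} (h : ∀ y, wordProb P y = wordProb Q y) : P = Q := by
  refine Subtype.ext (ext_of_generate_finite (μ := (P : Measure Cantor)) (ν := (Q : Measure Cantor))
    _ generateFrom_range_cyl isPiSystem_range_cyl ?_ (by simp))
  rintro _ ⟨y, rfl⟩
  exact (measureReal_eq_measureReal_iff).1 (h y)

theorem wordProb_nonneg (P : PMeas) (y : List Bool) : 0 ≤ wordProb P y := measureReal_nonneg

theorem wordProb_le_one (P : PMeas) (y : List Bool) : wordProb P y ≤ 1 := measureReal_le_one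

theorem effOpen_wordProb_lt :
    EffOpen basicMeas fun (z : List Bool × RatCode) P => wordProb P z.1 < (ratVal z.2 : ℝ) := by
  -- `(0, 1, 0)` codes `-1`, a vacuous lower bound.
  refine (effOpen_mem.comp (f := fun z : List Bool × RatCode => [(z.1, (0, 1, 0), z.2)])
    (Primrec.list_cons.comp (Primrec.fst.pair ((Primrec.const (0, 1, 0)).pair Primrec.snd))
      (Primrec.const [])).to_comp).of_iff fun z P => ?_
  have := wordProb_nonneg P z.1
  have h : (((ratVal (0, 1, 0) : ℚ)) : ℝ) < wordProb P z.1 := by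
    refine lt_of_lt_of_le ?_ this
    norm_num [ratVal]
  simp [basicMeas, h]

theorem effOpen_lt_wordProb :
    EffOpen basicMeas fun (z : List Bool × RatCode) P => (ratVal z.2 : ℝ) < wordProb P z.1 := by
  -- `(2, 0, 0)` codes `2`, a vacuous upper bound.
  refine (effOpen_mem.comp (f := fun z : List Bool × RatCode => [(z.1, z.2, (2, 0, 0))])
    (Primrec.list_cons.comp (Primrec.fst.pair (Primrec.snd.pair (Primrec.const (2, 0, 0))))
      (Primrec.const [])).to_comp).of_iff fun z P => ?_
  have := wordProb_le_one P z.1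
  have h : wordProb P z.1 < (((ratVal (2, 0, 0) : ℚ)) : ℝ) := by
    refine lt_of_le_of_lt this ?_
    norm_num [ratVal]
  simp [basicMeas, h]

/-- Intervals form a generating π-system, so distinct measures differ on some word, where a rational
separates them strictly. -/
theorem effOpen_ne {X ι : Type*} [Primcodable ι] {B : ι → Set X} (hB : EffBasis B)
    {f g : X → PMeas} (hf : EffCont B basicMeas f) (hg : EffCont B basicMeas g) :
    EffOpen B fun (_ : Unit) x => f x ≠ g x := by
  have h1 := (effOpen_wordProb_lt.comap hf).and hB (effOpen_lt_wordProb.comap hg)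
  have h2 := (effOpen_wordProb_lt.comap hg).and hB (effOpen_lt_wordProb.comap hf)
  refine ((h1.or h2).comp (Computable.snd (α := Unit))).exists.of_iff fun _ x => ?_
  constructor
  · intro h
    have : ∃ y, wordProb (f x) y ≠ wordProb (g x) y := by
      by_contra! hc
      exact h (pMeas_ext hc)
    obtain ⟨y, hy⟩ := this
    rcases hy.lt_or_gt with hy | hy <;> obtain ⟨q, hq⟩ := exists_rat_btwn hy <;>
      obtain ⟨c, rfl⟩ := exists_ratVal q
    · exact ⟨(y, c), Or.inl hq⟩
    · exact ⟨(y, c), Or.inr hq⟩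
  · rintro ⟨⟨y, c⟩, h | h⟩ he <;> simp only [he] at h
    · exact lt_asymm h.1 h.2
    · exact lt_asymm h.1 h.2

end Measures

/-! ### Uniform tests, r-tests and infima over names -/

section Tests

/-- The basic open sets of `Ω × M(Ω)`. -/
abbrev seqMeasB : List Bool × MeasCode → Set (Cantor × PMeas) := prodB cyl basicMeas

/-- The basic open sets of `Ω × Ω × M(Ω)`. -/
abbrev oracleSeqMeasB : List Bool × List Bool × MeasCode → Set (Cantor × Cantor × PMeas) :=
  prodB cyl seqMeasB

theorem effBasis_seqMeasB : EffBasis seqMeasB := effBasis_cyl.prod effBasis_basicMeas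

theorem effBasis_oracleSeqMeasB : EffBasis oracleSeqMeasB := effBasis_cyl.prod effBasis_seqMeasB

theorem effCont_oracle : EffCont oracleSeqMeasB cyl fun z => z.1 := effCont_fst effBasis_seqMeasB

theorem effCont_seq : EffCont oracleSeqMeasB cyl fun z => z.2.1 :=
  (effCont_fst effBasis_basicMeas).comp (effCont_snd effBasis_cyl)

theorem effCont_meas : EffCont oracleSeqMeasB basicMeas fun z => z.2.2 :=
  (effCont_snd effBasis_cyl).comp (effCont_snd effBasis_cyl)

theorem lowerSemicomputableMeas_iff {t : Cantor → PMeas → ℝ≥0∞} :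
    LowerSemicomputableMeas t ↔ EffOpen seqMeasB fun r z => RatLT r (t z.1 z.2) := by
  simp only [LowerSemicomputableMeas, EffOpen, Prod.forall (β := PMeas), Prod.exists, prodB,
    Set.mem_prod]

theorem lowerSemicomputableSeq_iff {u : Cantor → Cantor → ℝ≥0∞} :
    LowerSemicomputableSeq u ↔ EffOpen (prodB cyl cyl) fun r z => RatLT r (u z.1 z.2) := by
  simp only [LowerSemicomputableSeq, EffOpen, Prod.forall (β := Cantor), Prod.exists, prodB,
    Set.mem_prod]

theorem RatLT.mono {r : RatCode} {s s' : ℝ≥0∞} (h : RatLT r s) (hs : s ≤ s') : RatLT r s' :=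
  lt_of_lt_of_le h (EReal.coe_ennreal_le_coe_ennreal_iff.2 hs)

/-- Strict bounds on all members give only a weak bound on the infimum; the gap between `r` and `r'`
restores strictness. -/
theorem ratLT_iInf_iff {ι : Sort*} {r : RatCode} {p : ι → Prop} {f : ι → ℝ≥0∞} :
    RatLT r (⨅ (i) (_ : p i), f i) ↔
      ∃ r' : RatCode, ratVal r < ratVal r' ∧ ∀ i, ¬ p i ∨ RatLT r' (f i) := by
  constructor
  · intro h
    obtain ⟨r', h1, h2⟩ := RatLT_iff_exists.1 h
    refine ⟨r', h1, fun i => or_iff_not_imp_left.2 fun hi => h2.mono ?_⟩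
    exact iInf₂_le i (not_not.1 hi)
  · rintro ⟨r', h1, h2⟩
    by_contra h
    rw [RatLT, not_lt] at h
    have h3 : (((⨅ (i) (_ : p i), f i : ℝ≥0∞)) : EReal) < (((ratVal r' : ℚ) : ℝ) : EReal) :=
      h.trans_lt (by exact_mod_cast h1)
    have h4 : (((ratVal r' : ℚ) : ℝ) : EReal) =
        ((ENNReal.ofReal ((ratVal r' : ℚ) : ℝ) : ℝ≥0∞) : EReal) := by
      rw [EReal.coe_ennreal_ofReal, max_eq_left]
      exact EReal.coe_nonneg.1 ((EReal.coe_ennreal_nonneg _).trans h3.le)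
    rw [h4, EReal.coe_ennreal_lt_coe_ennreal_iff] at h3
    simp only [iInf_lt_iff] at h3
    obtain ⟨i, hi, h5⟩ := h3
    have h6 := (h2 i).resolve_left (not_not.2 hi)
    rw [RatLT, h4, EReal.coe_ennreal_lt_coe_ennreal_iff] at h6
    exact lt_asymm h5 h6

/-- The infimum of a family of tests over all names of a measure is a uniform test, because the
sets of names are uniformly effectively compact. -/
theorem isUniformTest_iInf {N : Cantor → PMeas → Prop}
    (hN : EffOpen oracleSeqMeasB fun (_ : Unit) z => ¬ N z.1 z.2.2) (hex : ∀ P, ∃ A, N A P)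
    {u : Cantor → Cantor → PMeas → ℝ≥0∞}
    (hu : EffOpen oracleSeqMeasB fun r z => RatLT r (u z.1 z.2.1 z.2.2))
    (hint : ∀ A P, N A P → ∫⁻ ω, u A ω P ∂(P : Measure Cantor) ≤ 1) :
    IsUniformTest fun ω P => ⨅ (A) (_ : N A P), u A ω P := by
  refine ⟨lowerSemicomputableMeas_iff.2 ?_, fun P => ?_⟩
  · have h1 := ((hN.comp (Computable.const ())).or hu).forall_cantor effBasis_seqMeasB
    have h2 := (h1.comp (Computable.snd (α := RatCode))).rePred_and
      (rePred_of_primrecPred primrecRel_ratVal_lt)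
    exact h2.exists.of_iff fun r z => ratLT_iInf_iff
  · obtain ⟨A, hA⟩ := hex P
    exact (lintegral_mono fun ω => iInf₂_le A hA).trans (hint A P hA)

theorem ComputableMap.effCont {R : Cantor → PMeas} (hR : ComputableMap R) :
    EffCont cyl basicMeas R := hR

theorem isRTest_of_isUniformTest {R : Cantor → PMeas} (hR : ComputableMap R)
    {t : Cantor → PMeas → ℝ≥0∞} (ht : IsUniformTest t) : IsRTest R fun ω A => t ω (R A) := by
  refine ⟨lowerSemicomputableSeq_iff.2 ?_, fun A => ht.2 _⟩
  have hB := effBasis_cyl.prod effBasis_cyl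
  exact (lowerSemicomputableMeas_iff.1 ht.1).comap (f := fun z : Cantor × Cantor => (z.1, R z.2))
    (EffCont.prodMk hB (effCont_fst effBasis_cyl)
      (hR.effCont.comp (effCont_snd effBasis_cyl)))

theorem isUniformTest_iInf_of_isRTest {R : Cantor → PMeas} (hR : IsRepresentation R)
    {u : Cantor → Cantor → ℝ≥0∞} (hu : IsRTest R u) :
    IsUniformTest fun ω P => ⨅ (A) (_ : R A = P), u ω A := by
  refine isUniformTest_iInf (N := fun A P => R A = P) (u := fun A ω _ => u ω A) ?_ hR.2 ?_ ?_
  · exact effOpen_ne effBasis_oracleSeqMeasB (hR.1.effCont.comp effCont_oracle) effCont_meas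
  · exact (lowerSemicomputableSeq_iff.1 hu.1).comap
      (f := fun z : Cantor × Cantor × PMeas => (z.2.1, z.1))
      (EffCont.prodMk effBasis_oracleSeqMeasB effCont_seq effCont_oracle)
  · rintro A _ rfl
    exact hu.2 A

theorem le_mul_iInf_of_isUniversalRTest {R : Cantor → PMeas} (hR : IsRepresentation R)
    {t : Cantor → PMeas → ℝ≥0∞} (ht : IsUniformTest t) {u : Cantor → Cantor → ℝ≥0∞}
    (hu : IsUniversalRTest R u) :
    ∃ c : ℝ≥0, ∀ ω P, t ω P ≤ c * ⨅ (A) (_ : R A = P), u ω A := by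
  obtain ⟨c, hc⟩ := hu.2 _ (isRTest_of_isUniformTest hR.1 ht)
  -- A nonzero constant is needed in order to divide by it.
  refine ⟨c + 1, fun ω P => ?_⟩
  have h0 : ((c + 1 : ℝ≥0) : ℝ≥0∞) ≠ 0 := by simp
  rw [mul_comm, ← ENNReal.div_le_iff h0 ENNReal.coe_ne_top]
  refine le_iInf₂ fun A hA => ?_
  rw [ENNReal.div_le_iff h0 ENNReal.coe_ne_top, mul_comm]
  subst hA
  refine (hc ω A).trans (mul_le_mul_left ?_ _)
  simp

end Tests

end AlgRandomness

namespace AlgRandomness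

open Encodable

/-! ### Randomness for a computable measure implies a finite test value -/

section ComputableMeasures

theorem ratVal_nat (a m : ℕ) : ((ratVal (a, 0, m) : ℚ) : ℝ) = a / (m + 1) := by
  simp [ratVal]

/-- If `A` computes `P` then the basic neighbourhoods of `P` are enumerable with oracle `A`. -/
theorem MeasComputableIn.effOpen_basicMeas {A : Cantor} {P : PMeas} (hP : MeasComputableIn A P) :
    EffOpen (oracleB A) fun (β : MeasCode) _ => P ∈ basicMeas β := by
  obtain ⟨f, hf, hfP⟩ := hP
  have hB := effBasis_oracleB A
  have hg := effOpen_graph_of_recursiveIn hf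
  have hm : Primrec fun z : (ℕ × (List Bool × RatCode × RatCode)) × RatCode =>
      ((1, 0, z.1.1) : RatCode) :=
    (Primrec.const 1).pair ((Primrec.const 0).pair (Primrec.fst.comp Primrec.fst))
  have he := Primrec.snd.comp
    (Primrec.fst (α := ℕ × (List Bool × RatCode × RatCode)) (β := RatCode))
  -- An approximation `δ` with error at most `ε = 1 / (m + 1)` certifies `u < P(y) < v` once `u + ε
  -- < δ` and `δ + ε < v`.
  have h1 := (hg.comp (f := fun z : (ℕ × (List Bool × RatCode × RatCode)) × RatCode =>
      ((z.1.2.1, ((1, 0, z.1.1) : RatCode)), z.2))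
    (((Primrec.fst.comp he).pair hm).pair Primrec.snd).to_comp).rePred_and
    (rePred_of_primrecPred
      ((primrecPred_ratVal_add_lt.comp
        ((Primrec.fst.comp (Primrec.snd.comp he)).pair (hm.pair Primrec.snd))).and
      (primrecPred_ratVal_add_lt.comp
        (Primrec.snd.pair (hm.pair (Primrec.snd.comp (Primrec.snd.comp he)))))))
  have h2 := (h1.exists.forall_mem_list hB).comp (f := fun z : MeasCode × ℕ => (z.2, z.1))
    (Primrec.snd.pair Primrec.fst).to_comp
  refine h2.exists.of_iff fun β _ => ?_
  have hpos : ∀ m : ℕ, 0 < ratVal (1, 0, m) := fun m => by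
    simp only [ratVal]
    positivity
  constructor
  · intro h
    -- A margin of `2 * ε` leaves one `ε` for the error of the approximation and one for the
    -- certificate.
    have key : ∀ᶠ m : ℕ in Filter.atTop, ∀ e ∈ {e | e ∈ β},
        ((ratVal e.2.1 : ℚ) : ℝ) + 2 * (1 / ((m : ℝ) + 1)) < wordProb P e.1 ∧
        wordProb P e.1 + 2 * (1 / ((m : ℝ) + 1)) < ((ratVal e.2.2 : ℚ) : ℝ) := by
      refine (Filter.eventually_all_finite (List.finite_toSet β)).2 fun e he => ?_
      have ht : Filter.Tendsto (fun m : ℕ => 2 * (1 / ((m : ℝ) + 1))) Filter.atTop (nhds 0) := by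
        simpa using tendsto_one_div_add_atTop_nhds_zero_nat.const_mul (2 : ℝ)
      obtain ⟨hu, hv⟩ := h e he
      have t1 := ht.const_add ((ratVal e.2.1 : ℚ) : ℝ)
      have t2 := ht.const_add (wordProb P e.1)
      rw [add_zero] at t1 t2
      exact (t1.eventually (gt_mem_nhds hu)).and (t2.eventually (gt_mem_nhds hv))
    obtain ⟨m, hm⟩ := key.exists
    refine ⟨m, fun e he => ⟨f (e.1, (1, 0, m)), ⟨?_, ?_⟩, Part.mem_some _⟩⟩
    all_goals
      have h3 := abs_le.1 (hfP e.1 (1, 0, m) (hpos m))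
      have h4 := hm e he
      have h5 := ratVal_nat 1 m
      push_cast at h5
      rw [← h5] at h4
      rw [← Rat.cast_lt (K := ℝ)]
      push_cast
      linarith [h3.1, h3.2, h4.1, h4.2]
  · rintro ⟨m, hm⟩ e he
    obtain ⟨δ, ⟨h3, h4⟩, h5⟩ := hm e he
    obtain rfl : δ = f (e.1, (1, 0, m)) := Part.mem_some_iff.1 h5
    have h6 := abs_le.1 (hfP e.1 (1, 0, m) (hpos m))
    rw [← Rat.cast_lt (K := ℝ)] at h3 h4
    push_cast at h3 h4
    constructor <;> linarith [h6.1, h6.2]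

theorem primrec_two_pow : Primrec fun i : ℕ => 2 ^ i := by
  refine (Primrec.nat_rec₁ 1 (f := fun _ a => 2 * a)
    (Primrec.nat_mul.comp (Primrec.const 2) Primrec.snd)).of_eq fun n => ?_
  induction n with
  | zero => rfl
  | succ n ih => rw [pow_succ', ← ih]

/-- Since `A` enumerates the neighbourhoods of `P`, the sets `{t > 2 ^ i}` are effectively open in
`A`; Markov's inequality bounds their measures, and a point of infinite test value lies in all of
them. -/
theorem lt_top_of_mlRandom {t : Cantor → PMeas → ℝ≥0∞} (ht : IsUniformTest t) {A ω : Cantor}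
    {P : PMeas} (hP : MeasComputableIn A P) (hω : MLRandom A P ω) : t ω P < ⊤ := by
  by_contra hc
  obtain ⟨⟨W, hW, hWt⟩, hint⟩ := ht
  let W' : ℕ × List Bool → Prop := fun z =>
    ∃ β, W (((2 ^ z.1, 0, 0) : RatCode), z.2, β) ∧ P ∈ basicMeas β
  have hW' : REPredIn A W' := by
    have h1 := (hP.effOpen_basicMeas.comp
      (Computable.snd (α := ℕ × List Bool))).rePred_and (hW.comp
        (f := fun z : (ℕ × List Bool) × MeasCode => (((2 ^ z.1.1, 0, 0) : RatCode), z.1.2, z.2))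
      (((primrec_two_pow.comp (Primrec.fst.comp Primrec.fst)).pair (Primrec.const (0, 0))).pair
        ((Primrec.snd.comp Primrec.fst).pair Primrec.snd)).to_comp)
    exact h1.exists.rePredIn
  have hU : ∀ (i : ℕ) (ω : Cantor), ω ∈ {ω | (2 : ℝ≥0∞) ^ i < t ω P} ↔
      ∃ x, W' (i, x) ∧ ω ∈ cyl x := by
    intro i ω
    have h1 := hWt (2 ^ i, 0, 0) ω P
    rw [RatLT_nat_iff] at h1
    push_cast at h1
    refine h1.trans ?_
    simp only [W']
    grind
  refine hω (fun i => {ω | (2 : ℝ≥0∞) ^ i < t ω P}) ⟨⟨W', hW', hU⟩, fun i => ?_⟩ ?_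
  · have hmeas : MeasurableSet {ω | (2 : ℝ≥0∞) ^ i < t ω P} := by
      have : {ω | (2 : ℝ≥0∞) ^ i < t ω P} = ⋃ x : {x // W' (i, x)}, cyl x.1 := by
        ext ω
        rw [hU]
        simp
      rw [this]
      exact MeasurableSet.iUnion fun x => measurableSet_cyl _
    have h1 : (2 : ℝ≥0∞) ^ i * (P : Measure Cantor) {ω | (2 : ℝ≥0∞) ^ i < t ω P} ≤ 1 := by
      rw [← lintegral_indicator_const hmeas]
      refine (lintegral_mono fun ω => ?_).trans (hint P)
      by_cases h : ω ∈ {ω | (2 : ℝ≥0∞) ^ i < t ω P}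
      · rw [Set.indicator_of_mem h]
        exact le_of_lt h
      · simp [Set.indicator_of_notMem h]
    rw [← ENNReal.inv_pow, ENNReal.le_inv_iff_mul_le, mul_comm]
    exact h1
  · rw [not_lt_top_iff] at hc
    refine Set.mem_iInter.2 fun i => ?_
    show (2 : ℝ≥0∞) ^ i < t ω P
    rw [hc]
    exact ENNReal.pow_lt_top (by simp)

end ComputableMeasures

/-! ### Names that compute their measure -/

section Names

/-- A sequence is a name of `P` if its bits are correct answers to questions that ask on which side
of some interval the value of `P` on a word lies. -/
def IsName (A : Cantor) (P : PMeas) : Prop :=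
  ∀ (y : List Bool) (a m : ℕ),
    (A (encode (y, a, m)) = true → (a : ℝ) / (m + 1) ≤ wordProb P y) ∧
    (A (encode (y, a, m)) = false → wordProb P y ≤ ((a + 1 : ℕ) : ℝ) / (m + 1))

theorem exists_isName (P : PMeas) : ∃ A, IsName A P := by
  classical
  refine ⟨fun n => (decode (α := List Bool × ℕ × ℕ) n).any
    fun z => decide ((z.2.1 : ℝ) / (z.2.2 + 1) ≤ wordProb P z.1), fun y a m => ?_⟩
  simp only [encodek, Option.any_some, decide_eq_true_eq, imp_self, decide_eq_false_iff_not,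
    not_le, true_and]
  intro h
  refine h.le.trans ?_
  gcongr
  simp

/-- Correct answers are weak inequalities, so a wrong one is refuted by a strict inequality and one
bit of `A`, both open conditions. -/
theorem effOpen_not_isName : EffOpen oracleSeqMeasB fun (_ : Unit) z => ¬ IsName z.1 z.2.2 := by
  have hB := effBasis_oracleSeqMeasB
  have hbit := effOpen_bit.comap effCont_oracle
  have henc : Primrec fun z : List Bool × ℕ × ℕ => encode z := Primrec.encode
  have hy := Primrec.fst (α := List Bool) (β := ℕ × ℕ)
  have ha := Primrec.fst.comp (Primrec.snd (α := List Bool) (β := ℕ × ℕ))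
  have hm := Primrec.snd.comp (Primrec.snd (α := List Bool) (β := ℕ × ℕ))
  have h1 := (hbit.comp (f := fun z : List Bool × ℕ × ℕ => (encode z, true))
    (henc.pair (Primrec.const true)).to_comp).and hB
    ((effOpen_wordProb_lt.comap effCont_meas).comp
      (f := fun z : List Bool × ℕ × ℕ => (z.1, ((z.2.1, 0, z.2.2) : RatCode)))
      (hy.pair (ha.pair ((Primrec.const 0).pair hm))).to_comp)
  have h2 := (hbit.comp (f := fun z : List Bool × ℕ × ℕ => (encode z, false))
    (henc.pair (Primrec.const false)).to_comp).and hB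
    ((effOpen_lt_wordProb.comap effCont_meas).comp
      (f := fun z : List Bool × ℕ × ℕ => (z.1, ((z.2.1 + 1, 0, z.2.2) : RatCode)))
      (hy.pair ((Primrec.succ.comp ha).pair ((Primrec.const 0).pair hm))).to_comp)
  refine (((h1.or h2).comp (Computable.snd (α := Unit))).exists).of_iff fun _ z => ?_
  simp only [ratVal_nat, IsName, Prod.exists]
  push Not
  grind

/-- For a fixed denominator `m + 1`, a place where the answers switch from true at `a - 1` to false
at `a` (or `a = 0`) locates `P(y)` within `1 / (m + 1)` of `a / (m + 1)`. The denominator of the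
code of `ε` already gives enough precision. -/
theorem IsName.measComputableIn {A : Cantor} {P : PMeas} (h : IsName A P) :
    MeasComputableIn A P := by
  have hB := effBasis_oracleB A
  let p : (List Bool × RatCode) × RatCode → Unit → Prop := fun z _ =>
    ∃ a : ℕ, z.2 = (a, 0, z.1.2.2.2) ∧ (A (encode (z.1.1, a, z.1.2.2.2)) = false ∧
      (a = 0 ∨ A (encode (z.1.1, a - 1, z.1.2.2.2)) = true))
  have hp : EffOpen (oracleB A) p := by
    have hbit := effOpen_bit.comap (effCont_oracleB A)
    have x1 := Primrec.fst.comp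
      (Primrec.fst.comp (Primrec.fst (α := (List Bool × RatCode) × RatCode) (β := ℕ)))
    have x2 := Primrec.snd.comp (Primrec.snd.comp (Primrec.snd.comp
      (Primrec.fst.comp (Primrec.fst (α := (List Bool × RatCode) × RatCode) (β := ℕ)))))
    have xa := Primrec.snd (α := (List Bool × RatCode) × RatCode) (β := ℕ)
    have h1 := hbit.comp (f := fun z : ((List Bool × RatCode) × RatCode) × ℕ =>
      (encode (z.1.1.1, z.2, z.1.1.2.2.2), false))
      ((Primrec.encode.comp (x1.pair (xa.pair x2))).pair (Primrec.const false)).to_comp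
    have h2 := hbit.comp (f := fun z : ((List Bool × RatCode) × RatCode) × ℕ =>
      (encode (z.1.1.1, z.2 - 1, z.1.1.2.2.2), true))
      ((Primrec.encode.comp (x1.pair ((Primrec.pred.comp xa).pair x2))).pair
        (Primrec.const true)).to_comp
    have h3 := (EffOpen.of_rePred hB (rePred_of_primrecPred
      (Primrec.eq.comp xa (Primrec.const 0)))).or h2
    exact ((h1.and hB h3).rePred_and (rePred_of_primrecPred (Primrec.eq.comp
      (Primrec.snd.comp Primrec.fst) (xa.pair ((Primrec.const 0).pair x2))))).exists
  obtain ⟨f, hf, hfp⟩ := hp.exists_computableIn fun z => by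
    have hex : ∃ a : ℕ, A (encode (z.1, a, z.2.2.2)) = false := by
      -- A true answer here would make the probability exceed `1`.
      refine ⟨z.2.2.2 + 2, ?_⟩
      by_contra hc
      rw [Bool.not_eq_false] at hc
      have h1 := ((h z.1 _ _).1 hc).trans (wordProb_le_one P _)
      rw [div_le_one (by positivity)] at h1
      push_cast at h1
      linarith
    refine ⟨(Nat.find hex, 0, z.2.2.2), Nat.find hex, rfl, Nat.find_spec hex, ?_⟩
    refine or_iff_not_imp_left.2 fun h0 => ?_
    have := Nat.find_min hex (Nat.sub_lt (Nat.pos_of_ne_zero h0) one_pos)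
    simpa using this
  refine ⟨f, hf, fun y ε hε => ?_⟩
  obtain ⟨a, h1, h2, h3⟩ := hfp (y, ε)
  obtain ⟨p, q, m⟩ := ε
  dsimp only at h1 h2 h3
  rw [h1, ratVal_nat]
  have h4 := (h y a m).2 h2
  have h5 : (a : ℝ) / (m + 1) - 1 / (m + 1) ≤ wordProb P y := by
    rcases Nat.eq_zero_or_pos a with rfl | ha
    · have := wordProb_nonneg P y
      have h6 : (0 : ℝ) ≤ 1 / (m + 1) := by positivity
      simp only [Nat.cast_zero, zero_div, zero_sub]
      linarith
    · have := (h y (a - 1) m).1 (h3.resolve_left ha.ne')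
      rw [Nat.cast_sub ha, Nat.cast_one, sub_div] at this
      exact this
  -- A positive `(p - q) / (m + 1)` has an integer numerator, hence at least `1`.
  have h6 : (1 : ℝ) / (m + 1) ≤ ((ratVal (p, q, m) : ℚ) : ℝ) := by
    have hpq : q < p := by
      by_contra hc
      refine hε.not_ge ?_
      refine div_nonpos_of_nonpos_of_nonneg ?_ (by positivity)
      rw [sub_nonpos]
      exact_mod_cast not_lt.1 hc
    have : ((ratVal (p, q, m) : ℚ) : ℝ) = ((p : ℝ) - q) / (m + 1) := by simp [ratVal]
    rw [this]
    gcongr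
    have : (q : ℝ) + 1 ≤ p := by exact_mod_cast hpq
    linarith
  push_cast at h4
  rw [add_div] at h4
  rw [abs_le]
  constructor <;> linarith

end Names

end AlgRandomness

namespace AlgRandomness

open Encodable Nat.Partrec

/-! ### A test universal uniformly in the oracle and the measure -/

section OracleTest

/-- The word `z` has, by stage `n` and with the bits `w` of the oracle, a prefix that the code `c`
has enumerated into the component number `i + 1` of its test. -/
def Hit (z : List Bool) (s : (Code × ℕ) × List Bool) : Prop :=
  ∃ m ∈ List.range s.2.length, ∃ a ∈ decode (α := (ℕ × List Bool) × List Bool) m,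
    (a.1.1 = s.1.2 + 1 ∧ a.1.2 <+: z) ∧ (a.2 <+: s.2 ∧
      (s.1.1.evaln s.2.length (encode a)).isSome)

theorem primrecRel_hit : PrimrecRel Hit := by
  have h1 : PrimrecPred fun x : (List Bool × (Code × ℕ) × List Bool) ×
      ((ℕ × List Bool) × List Bool) =>
      (x.2.1.1 = x.1.2.1.2 + 1 ∧ x.2.1.2 <+: x.1.1) ∧ (x.2.2 <+: x.1.2.2 ∧
        (x.1.2.1.1.evaln x.1.2.2.length (encode x.2)).isSome) := by
    have s := Primrec.snd.comp (Primrec.fst (α := List Bool × (Code × ℕ) × List Bool)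
      (β := (ℕ × List Bool) × List Bool))
    have z := Primrec.fst.comp (Primrec.fst (α := List Bool × (Code × ℕ) × List Bool)
      (β := (ℕ × List Bool) × List Bool))
    have a := Primrec.snd (α := List Bool × (Code × ℕ) × List Bool)
      (β := (ℕ × List Bool) × List Bool)
    refine PrimrecPred.and (PrimrecPred.and ?_ ?_) (PrimrecPred.and ?_ ?_)
    · exact Primrec.eq.comp (Primrec.fst.comp (Primrec.fst.comp a))
        (Primrec.succ.comp (Primrec.snd.comp (Primrec.fst.comp s)))
    · exact primrecRel_isPrefix.comp (Primrec.snd.comp (Primrec.fst.comp a)) z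
    · exact primrecRel_isPrefix.comp (Primrec.snd.comp a) (Primrec.snd.comp s)
    · exact primrecPred_evaln_isSome.comp
        (((Primrec.list_length.comp (Primrec.snd.comp s)).pair
          (Primrec.fst.comp (Primrec.fst.comp s))).pair (Primrec.encode.comp a))
  have h2 := h1.exists_decode.comp (f := fun p : ℕ × (List Bool × (Code × ℕ) × List Bool) =>
    (p.2, p.1)) (Primrec.snd.pair Primrec.fst)
  exact h2.primrecRel.exists_mem_list.comp (Primrec.list_range.comp (Primrec.list_length.comp
    (Primrec.snd.comp Primrec.snd))) Primrec.id

open Classical in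
/-- The words of length `w.length` that have been hit with the bits `w` of the oracle. -/
noncomputable def stage (s : (Code × ℕ) × List Bool) : List (List Bool) :=
  (words s.2.length).filter (Hit · s)

theorem primrec_stage : Primrec stage := by
  classical
  exact (primrecRel_hit.listFilter).comp
    (primrec_words.comp (Primrec.list_length.comp Primrec.snd)) Primrec.id

theorem mem_stage {s : (Code × ℕ) × List Bool} {z : List Bool} :
    z ∈ stage s ↔ z.length = s.2.length ∧ Hit z s := by
  simp [stage]

theorem nodup_stage (s : (Code × ℕ) × List Bool) : (stage s).Nodup :=
  (nodup_words _).filter _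

/-- The union of the intervals of a list of words. -/
def cylUnion (Z : List (List Bool)) : Set Cantor := ⋃ z ∈ Z, cyl z

theorem mem_cylUnion {Z : List (List Bool)} {ω : Cantor} :
    ω ∈ cylUnion Z ↔ ∃ z ∈ Z, ω ∈ cyl z := by
  simp [cylUnion]

theorem measurableSet_cylUnion (Z : List (List Bool)) : MeasurableSet (cylUnion Z) :=
  MeasurableSet.iUnion fun _ => MeasurableSet.iUnion fun _ => measurableSet_cyl _

/-- Hits survive more steps, more oracle bits and longer words, so a word can be replaced by a
longer prefix of the same sequence. -/
theorem stage_mono (c : Code) (i : ℕ) (A : Cantor) :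
    Monotone fun n => cylUnion (stage ((c, i), initSeg A n)) := by
  intro n n' hn ω hω
  rw [mem_cylUnion] at hω ⊢
  obtain ⟨z, hz, hωz⟩ := hω
  obtain ⟨hzl, m, hm, a, ha, ⟨h1, h2⟩, h3, h4⟩ := mem_stage.1 hz
  simp only [length_initSeg, List.mem_range] at hzl hm h4
  refine ⟨initSeg ω n', mem_stage.2 ⟨by simp, m, ?_, a, ha, ⟨h1, ?_⟩, ?_, ?_⟩,
    mem_cyl_initSeg ω n'⟩
  · simpa using hm.trans_le hn
  · exact h2.trans (prefix_initSeg_iff.2 ⟨hωz, hzl.trans_le hn⟩)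
  · exact h3.trans (initSeg_isPrefix A hn)
  · simp only [length_initSeg]
    obtain ⟨v, hv⟩ := Option.isSome_iff_exists.1 h4
    exact Option.isSome_iff_exists.2 ⟨v, Code.evaln_mono hn hv⟩

/-- Rational upper bounds for the measures of the words of a list witness that their sum is
at most `2⁻ⁱ`. -/
def SmallSum (s : List (List Bool) × ℕ) (P : PMeas) : Prop :=
  ∃ b : List (List Bool × ℕ) × ℕ,
    (b.1.map Prod.fst = s.1 ∧ (b.1.map Prod.snd).sum * 2 ^ s.2 ≤ b.2 + 1) ∧
      ∀ m ∈ b.1, wordProb P m.1 < (ratVal (m.2, 0, b.2) : ℝ)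

theorem effOpen_smallSum : EffOpen basicMeas SmallSum := by
  have h1 := effOpen_wordProb_lt.comp (f := fun z : ℕ × (List Bool × ℕ) =>
    (z.2.1, ((z.2.2, 0, z.1) : RatCode)))
    ((Primrec.fst.comp Primrec.snd).pair ((Primrec.snd.comp Primrec.snd).pair
      ((Primrec.const 0).pair Primrec.fst))).to_comp
  have h2 := (h1.forall_mem_list effBasis_basicMeas).comp
    (f := fun z : (List (List Bool) × ℕ) × (List (List Bool × ℕ) × ℕ) => (z.2.2, z.2.1))
    ((Primrec.snd.comp Primrec.snd).pair (Primrec.fst.comp Primrec.snd)).to_comp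
  have hsum : Primrec (List.sum : List ℕ → ℕ) :=
    Primrec.list_foldr Primrec.id (Primrec.const 0)
      (Primrec.nat_add.comp (Primrec.fst.comp Primrec.snd) (Primrec.snd.comp Primrec.snd)).to₂
  have b := Primrec.snd (α := List (List Bool) × ℕ) (β := List (List Bool × ℕ) × ℕ)
  have s := Primrec.fst (α := List (List Bool) × ℕ) (β := List (List Bool × ℕ) × ℕ)
  refine (h2.rePred_and (rePred_of_primrecPred (PrimrecPred.and
    (Primrec.eq.comp (Primrec.list_map (Primrec.fst.comp b) (Primrec.fst.comp Primrec.snd).to₂)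
      (Primrec.fst.comp s))
    (Primrec.nat_le.comp (Primrec.nat_mul.comp (hsum.comp (Primrec.list_map (Primrec.fst.comp b)
      (Primrec.snd.comp Primrec.snd).to₂)) (primrec_two_pow.comp (Primrec.snd.comp s)))
      (Primrec.succ.comp (Primrec.snd.comp b)))))).exists.of_iff fun s P => Iff.rfl

theorem SmallSum.measure_le {Z : List (List Bool)} {i : ℕ} {P : PMeas} (h : SmallSum (Z, i) P) :
    (P : Measure Cantor) (cylUnion Z) ≤ (2⁻¹ : ℝ≥0∞) ^ i := by
  obtain ⟨⟨M, N⟩, ⟨rfl, h2⟩, h3⟩ := h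
  dsimp only at h2 h3 ⊢
  have h4 : (P : Measure Cantor).real (cylUnion (M.map Prod.fst)) ≤
      (((M.map Prod.snd).sum : ℕ) : ℝ) / (N + 1) := by
    clear h2
    induction M with
    | nil => simp [cylUnion]
    | cons m M ih =>
      have hu : cylUnion ((m :: M).map Prod.fst) = cyl m.1 ∪ cylUnion (M.map Prod.fst) := by
        ext ω
        simp [mem_cylUnion]
      rw [hu]
      refine (measureReal_union_le _ _).trans ?_
      have h5 := (h3 m (by simp)).le
      have h6 := ih fun m' hm' => h3 m' (by simp [hm'])
      rw [ratVal_nat] at h5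
      simp only [List.map_cons, List.sum_cons, Nat.cast_add, add_div]
      exact add_le_add h5 h6
  have h5 : (((M.map Prod.snd).sum : ℕ) : ℝ) / (N + 1) ≤ (2⁻¹ : ℝ) ^ i := by
    rw [div_le_iff₀ (by positivity), inv_pow, inv_mul_eq_div, le_div_iff₀ (by positivity)]
    exact_mod_cast h2
  have h6 := h4.trans h5
  exact (ENNReal.toReal_le_toReal (measure_ne_top _ _) (by simp)).1
    (by rw [ENNReal.toReal_pow, ENNReal.toReal_inv, ENNReal.toReal_ofNat]; exact h6)

/-- Distinct words of equal length have disjoint intervals, so the measure is the sum of their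
probabilities. The spare factor of two absorbs rounding these up to strict rational bounds. -/
theorem smallSum_of_measure_le {Z : List (List Bool)} {i l : ℕ} {P : PMeas} (hnd : Z.Nodup)
    (hl : ∀ z ∈ Z, z.length = l)
    (h : (P : Measure Cantor) (cylUnion Z) ≤ (2⁻¹ : ℝ≥0∞) ^ (i + 1)) : SmallSum (Z, i) P := by
  have h1 : (P : Measure Cantor) (cylUnion Z) = ∑ z ∈ Z.toFinset, (P : Measure Cantor) (cyl z) := by
    rw [← measure_biUnion_finset]
    · simp [cylUnion]
    · intro x hx y hy hxy
      simp only [List.coe_toFinset] at hx hy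
      exact disjoint_cyl ((hl x hx).trans (hl y hy).symm) hxy
    · exact fun z _ => measurableSet_cyl z
  have h2 : (Z.map (wordProb P)).sum ≤ (2⁻¹ : ℝ) ^ (i + 1) := by
    have h3 : (P : Measure Cantor).real (cylUnion Z) = (Z.map (wordProb P)).sum := by
      rw [← List.sum_toFinset _ hnd, Measure.real, h1, ENNReal.toReal_sum]
      · rfl
      · exact fun _ _ => measure_ne_top _ _
    rw [← h3, Measure.real]
    have := ENNReal.toReal_mono (by simp) h
    simpa using this
  have h3 : ∀ N : ℕ, (((Z.map fun z => ⌊wordProb P z * (N + 1)⌋₊ + 1).sum : ℕ) : ℝ) ≤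
      (Z.map (wordProb P)).sum * (N + 1) + Z.length := by
    intro N
    clear hl h h1 h2 hnd
    induction Z with
    | nil => simp
    | cons z Z ih =>
      have := Nat.floor_le (mul_nonneg (wordProb_nonneg P z) (by positivity : (0 : ℝ) ≤ N + 1))
      simp only [List.map_cons, List.sum_cons, List.length_cons]
      push_cast at ih ⊢
      linarith
  -- Each word costs at most `1 / (N + 1)` in rounding; this `N` keeps the total within `2⁻¹ ^ (i +
  -- 1)`.
  let N := Z.length * 2 ^ (i + 1)
  refine ⟨(Z.map fun z => (z, ⌊wordProb P z * (N + 1)⌋₊ + 1), N), ⟨?_, ?_⟩, ?_⟩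
  · simp [Function.comp_def]
  · simp only [List.map_map, Function.comp_def]
    have h4 := h3 N
    have h5 : (Z.map (wordProb P)).sum * (N + 1) ≤ (2⁻¹ : ℝ) ^ (i + 1) * (N + 1) := by gcongr
    have h6 : (Z.length : ℝ) ≤ (2⁻¹ : ℝ) ^ (i + 1) * (N + 1) := by
      have : (Z.length : ℝ) = (2⁻¹ : ℝ) ^ (i + 1) * N := by
        simp only [N]
        push_cast
        rw [inv_pow]
        field_simp
      rw [this]
      gcongr
      linarith
    have h7 : (2⁻¹ : ℝ) ^ (i + 1) * 2 = (2⁻¹ : ℝ) ^ i := by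
      rw [pow_succ, mul_assoc]
      norm_num
    have h8 : (((Z.map fun z => ⌊wordProb P z * (N + 1)⌋₊ + 1).sum : ℕ) : ℝ) * 2 ^ i ≤ N + 1 := by
      have h9 : (((Z.map fun z => ⌊wordProb P z * (N + 1)⌋₊ + 1).sum : ℕ) : ℝ) ≤
          (2⁻¹ : ℝ) ^ i * (N + 1) := by
        rw [← h7]
        linarith
      rw [inv_pow, inv_mul_eq_div, le_div_iff₀ (by positivity)] at h9
      exact h9
    exact_mod_cast h8
  · simp only [List.mem_map, forall_exists_index, and_imp, forall_apply_eq_imp_iff₂]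
    intro z _
    rw [ratVal_nat, lt_div_iff₀ (by positivity)]
    push_cast
    exact Nat.lt_floor_add_one _

/-- The words enumerated by stage `n` with oracle `A` into the part of the code number `j` in the
component number `k` of the universal test. -/
noncomputable def testStage (j k : ℕ) (A : Cantor) (n : ℕ) : List (List Bool) :=
  stage ((Denumerable.ofNat Code j, j + 2 * k + 2), initSeg A n)

/-- The component number `k` of a Martin-Löf test that is universal uniformly in the oracle and the
measure: the stages of the enumerated sets are included as long as their measure is small. -/
def OracleTest (k : ℕ) (z : Cantor × Cantor × PMeas) : Prop :=
  ∃ j n, z.2.1 ∈ cylUnion (testStage j k z.1 n) ∧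
    SmallSum (testStage j k z.1 n, j + 2 * k + 2) z.2.2

theorem effOpen_oracleTest : EffOpen oracleSeqMeasB OracleTest := by
  have hB := effBasis_oracleSeqMeasB
  have hk := Primrec.fst (α := ℕ) (β := (ℕ × List Bool) × List Bool)
  have hb := Primrec.snd (α := ℕ) (β := (ℕ × List Bool) × List Bool)
  have hj := Primrec.fst.comp (Primrec.fst.comp hb)
  have hw := Primrec.snd.comp (Primrec.fst.comp hb)
  have hx := Primrec.snd.comp hb
  have hi := Primrec.nat_add.comp (Primrec.nat_add.comp hj
    (Primrec.nat_mul.comp (Primrec.const 2) hk)) (Primrec.const 2)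
  have hZ := primrec_stage.comp ((((Primrec.ofNat Code).comp hj).pair hi).pair hw)
  have hmem : PrimrecRel fun (Z : List (List Bool)) x => ∃ z ∈ Z, z = x :=
    PrimrecRel.exists_mem_list Primrec.eq
  have h1 := ((effOpen_mem.comap effCont_oracle).comp hw.to_comp).and hB
    (((effOpen_mem.comap effCont_seq).comp hx.to_comp).and hB
      ((effOpen_smallSum.comap effCont_meas).comp (hZ.pair hi).to_comp))
  -- The quantifier over stages becomes one over a prefix `w` of the oracle and a word `x` of the
  -- stage; `w.length` recovers the stage number.
  refine ((h1.rePred_and (rePred_of_primrecPred (hmem.comp hZ hx))).exists).of_iff ?_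
  rintro k ⟨A, ω, P⟩
  simp only [OracleTest, mem_cylUnion, Prod.exists, testStage, exists_eq_right]
  constructor
  · rintro ⟨j, n, ⟨x, hx, hω⟩, hS⟩
    exact ⟨j, initSeg A n, x, hx, mem_cyl_initSeg A n, hω, hS⟩
  · rintro ⟨j, w, x, hx, hA, hω, hS⟩
    rw [mem_cyl_iff] at hA
    rw [← hA] at hx hS
    exact ⟨j, w.length, ⟨x, hx, hω⟩, hS⟩

theorem oracleTest_eq_iUnion (k : ℕ) (A : Cantor) (P : PMeas) :
    {ω | OracleTest k (A, ω, P)} =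
      ⋃ j, ⋃ n : {n // SmallSum (testStage j k A n, j + 2 * k + 2) P},
        cylUnion (testStage j k A n) := by
  ext ω
  simp only [OracleTest, Set.mem_iUnion, Subtype.exists, exists_prop, Set.mem_ofPred_eq, and_comm]

theorem measurableSet_oracleTest (k : ℕ) (A : Cantor) (P : PMeas) :
    MeasurableSet {ω | OracleTest k (A, ω, P)} := by
  rw [oracleTest_eq_iUnion]
  exact MeasurableSet.iUnion fun _ => MeasurableSet.iUnion fun _ => measurableSet_cylUnion _

theorem tsum_inv_two_pow_succ : ∑' n : ℕ, (2⁻¹ : ℝ≥0∞) ^ (n + 1) = 1 := by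
  rw [ENNReal.tsum_geometric_add_one, ENNReal.one_sub_inv_two, inv_inv,
    ENNReal.inv_mul_cancel (by simp) (by simp)]

/-- For each code number `j` the accepted stages increase, so their union obeys their common bound
`2⁻¹ ^ (j + 2 * k + 2)`; these bounds sum over `j` to the claim. -/
theorem measure_oracleTest_le (k : ℕ) (A : Cantor) (P : PMeas) :
    (P : Measure Cantor) {ω | OracleTest k (A, ω, P)} ≤ (2⁻¹ : ℝ≥0∞) ^ (2 * k + 1) := by
  rw [oracleTest_eq_iUnion]
  refine (measure_iUnion_le _).trans ?_
  have h1 : ∀ j, (P : Measure Cantor)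
      (⋃ n : {n // SmallSum (testStage j k A n, j + 2 * k + 2) P},
        cylUnion (testStage j k A n)) ≤ (2⁻¹ : ℝ≥0∞) ^ (2 * k + 1) * 2⁻¹ ^ (j + 1) := by
    intro j
    have hmono : Monotone fun n : {n // SmallSum (testStage j k A n, j + 2 * k + 2) P} =>
        cylUnion (testStage j k A n) := fun n n' h => stage_mono _ _ A h
    rw [hmono.measure_iUnion]
    refine iSup_le fun n => n.2.measure_le.trans_eq ?_
    rw [← pow_add]
    congr 1
    ring
  refine (ENNReal.tsum_le_tsum h1).trans_eq ?_
  rw [ENNReal.tsum_mul_left]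
  rw [tsum_inv_two_pow_succ, mul_one]

/-- The test that takes values at least `k` on the component number `k` of the universal
Martin-Löf test. -/
noncomputable def oracleDeficiency (A ω : Cantor) (P : PMeas) : ℝ≥0∞ :=
  ⨆ (k : ℕ) (_ : OracleTest k (A, ω, P)), (k : ℝ≥0∞)

theorem ratLT_iff {r : RatCode} {s : ℝ≥0∞} :
    RatLT r s ↔ ratVal r < 0 ∨ ENNReal.ofReal (ratVal r : ℚ) < s := by
  rcases lt_or_ge (ratVal r) 0 with h | h
  · simp only [h, true_or, iff_true]
    refine lt_of_lt_of_le ?_ (EReal.coe_ennreal_nonneg s)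
    exact_mod_cast h
  · simp only [h.not_gt, false_or]
    have h1 : (((ratVal r : ℚ) : ℝ) : EReal) =
        ((ENNReal.ofReal ((ratVal r : ℚ) : ℝ) : ℝ≥0∞) : EReal) := by
      rw [EReal.coe_ennreal_ofReal, max_eq_left]
      exact_mod_cast h
    rw [RatLT, h1, EReal.coe_ennreal_lt_coe_ennreal_iff]

theorem effOpen_oracleDeficiency :
    EffOpen oracleSeqMeasB fun r z => RatLT r (oracleDeficiency z.1 z.2.1 z.2.2) := by
  have h1 := (effOpen_oracleTest.comp (Computable.snd (α := RatCode))).rePred_and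
    (rePred_of_primrecPred (primrecRel_ratVal_lt.comp Primrec.fst
      (Primrec.pair Primrec.snd (Primrec.const (0, 0)))))
  have h2 := (EffOpen.of_rePred effBasis_oracleSeqMeasB (rePred_of_primrecPred
    (primrecRel_ratVal_lt.comp Primrec.id (Primrec.const (0, 0, 0))))).or h1.exists
  refine h2.of_iff fun r z => ?_
  have h0 : ratVal (0, 0, 0) = 0 := by simp [ratVal]
  simp only [ratLT_iff, oracleDeficiency, lt_iSup_iff, id, h0]
  refine or_congr_right' fun hr => exists_congr fun k => ?_
  have hk : ratVal (k, 0, 0) = k := by simp [ratVal]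
  rw [exists_prop, hk, and_comm, and_congr_left_iff]
  intro _
  rw [← ENNReal.ofReal_natCast, ENNReal.ofReal_lt_ofReal_iff_of_nonneg
    (by exact_mod_cast not_lt.1 hr)]
  exact_mod_cast Iff.rfl

/-- The exponent `2 * k + 1` pays for the weight `k ≤ 2 ^ k` and still leaves the summable `2⁻¹ ^ (k
+ 1)`. -/
theorem lintegral_oracleDeficiency_le (A : Cantor) (P : PMeas) :
    ∫⁻ ω, oracleDeficiency A ω P ∂(P : Measure Cantor) ≤ 1 := by
  have h1 : ∀ ω, oracleDeficiency A ω P ≤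
      ∑' k : ℕ, {ω | OracleTest k (A, ω, P)}.indicator (fun _ => (k : ℝ≥0∞)) ω := by
    intro ω
    refine iSup₂_le fun k hk => ?_
    refine le_trans ?_ (ENNReal.le_tsum k)
    rw [Set.indicator_of_mem (by exact hk)]
  refine (lintegral_mono h1).trans ?_
  rw [lintegral_tsum fun k => (measurable_const.indicator
    (measurableSet_oracleTest k A P)).aemeasurable]
  have h2 : ∀ k : ℕ, ∫⁻ ω, {ω | OracleTest k (A, ω, P)}.indicator (fun _ => (k : ℝ≥0∞)) ω
      ∂(P : Measure Cantor) ≤ (2⁻¹ : ℝ≥0∞) ^ (k + 1) := by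
    intro k
    rw [lintegral_indicator_const (measurableSet_oracleTest k A P)]
    calc (k : ℝ≥0∞) * (P : Measure Cantor) {ω | OracleTest k (A, ω, P)}
        ≤ 2 ^ k * (2⁻¹ : ℝ≥0∞) ^ (2 * k + 1) := by
          gcongr
          · exact_mod_cast Nat.lt_two_pow_self.le
          · exact measure_oracleTest_le k A P
      _ = (2⁻¹ : ℝ≥0∞) ^ (k + 1) := by
          rw [show 2 * k + 1 = k + (k + 1) by ring, pow_add, ← mul_assoc, ← mul_pow,
            ENNReal.mul_inv_cancel (by simp) (by simp), one_pow, one_mul]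
  exact (ENNReal.tsum_le_tsum h2).trans_eq tsum_inv_two_pow_succ

/-- A Martin-Löf test that captures `ω` is enumerated by some code `c`. For each `k` the stages of
`c` lie in `U (i + 1)` with `i = encode c + 2 * k + 2`; the extra `1` supplies the factor of two
under which every stage is accepted. So `ω` is caught in every component and its deficiency is
infinite. -/
theorem mlRandom_of_oracleDeficiency_lt_top {A ω : Cantor} {P : PMeas}
    (h : oracleDeficiency A ω P < ⊤) : MLRandom A P ω := by
  rintro U ⟨⟨W, hW, hWU⟩, hU⟩ hω
  obtain ⟨V, hV, hVW⟩ := hW.effOpen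
  obtain ⟨c, hc⟩ := exists_code_of_rePred hV
  refine h.ne (ENNReal.eq_top_of_forall_nnreal_le fun r => ?_)
  obtain ⟨k, hk⟩ := exists_nat_ge r
  refine le_trans (b := (k : ℝ≥0∞)) (by exact_mod_cast hk) (le_iSup₂_of_le k ?_ le_rfl)
  have hj : Denumerable.ofNat Code (encode c) = c := Denumerable.ofNat_encode c
  set i := encode c + 2 * k + 2 with hi
  have hsub : ∀ n, cylUnion (testStage (encode c) k A n) ⊆ U (i + 1) := by
    intro n ω' hω'
    rw [testStage, hj, mem_cylUnion] at hω'
    obtain ⟨z, hz, hω'⟩ := hω'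
    obtain ⟨-, m, -, a, -, ⟨h1, h2⟩, h3, h4⟩ := mem_stage.1 hz
    have h5 := (hc a).2 ⟨_, h4⟩
    refine (hWU _ _).2 ⟨a.1.2, ?_, mem_cyl_of_isPrefix h2 hω'⟩
    refine (hVW (i + 1, a.1.2) ()).2 ⟨a.2, ?_, mem_cyl_of_isPrefix h3 (mem_cyl_initSeg A n)⟩
    rw [← h1]
    exact h5
  obtain ⟨x, hx, hωx⟩ := (hWU _ _).1 (Set.mem_iInter.1 hω (i + 1))
  obtain ⟨y, hy, hAy⟩ := (hVW (i + 1, x) ()).1 hx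
  obtain ⟨s, hs⟩ := (hc _).1 hy
  let a : (ℕ × List Bool) × List Bool := ((i + 1, x), y)
  -- The stage must exceed the running time and the code of `a`, and reach the lengths of both
  -- prefixes.
  let n := max (max s (encode a + 1)) (max x.length y.length)
  refine ⟨encode c, n, mem_cylUnion.2 ⟨initSeg ω n, ?_, mem_cyl_initSeg ω n⟩, ?_⟩
  · rw [testStage, hj]
    refine mem_stage.2 ⟨by simp, encode a, ?_, a, by simp, ⟨rfl, ?_⟩, ?_, ?_⟩
    · simp only [length_initSeg, List.mem_range]
      exact lt_of_lt_of_le (Nat.lt_succ_self _) ((le_max_right _ _).trans (le_max_left _ _))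
    · exact prefix_initSeg_iff.2 ⟨hωx, (le_max_left _ _).trans (le_max_right _ _)⟩
    · exact prefix_initSeg_iff.2 ⟨hAy, (le_max_right _ _).trans (le_max_right _ _)⟩
    · obtain ⟨v, hv⟩ := Option.isSome_iff_exists.1 hs
      simp only [length_initSeg]
      exact Option.isSome_iff_exists.2
        ⟨v, Code.evaln_mono ((le_max_left _ _).trans (le_max_left _ _)) hv⟩
  · refine smallSum_of_measure_le (l := n) (nodup_stage _) (fun z hz => ?_)
      ((measure_mono (hsub n)).trans (hU _))
    simpa using (mem_stage.1 hz).1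

/-- By universality, the infimum of the deficiency over the names of `P` is finite wherever `t` is,
so one of the names has finite deficiency; that name is the oracle. -/
theorem exists_oracle_of_lt_top {t : Cantor → PMeas → ℝ≥0∞} (ht : IsUniversalUniformTest t)
    {ω : Cantor} {P : PMeas} (h : t ω P < ⊤) : ∃ A, MeasComputableIn A P ∧ MLRandom A P ω := by
  obtain ⟨c, hc⟩ := ht.2 _ (isUniformTest_iInf effOpen_not_isName exists_isName
    effOpen_oracleDeficiency fun A P _ => lintegral_oracleDeficiency_le A P)
  have h1 := (hc ω P).trans_lt (ENNReal.mul_lt_top ENNReal.coe_lt_top h)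
  simp only [iInf_lt_iff] at h1
  obtain ⟨A, hA, h2⟩ := h1
  exact ⟨A, hA.measComputableIn, mlRandom_of_oracleDeficiency_lt_top h2⟩

end OracleTest

end AlgRandomness

theorem mainTheorem6 (t : AlgRandomness.Cantor → AlgRandomness.PMeas → ℝ≥0∞)
    (ht : AlgRandomness.IsUniversalUniformTest t) :
    (∀ (ω : AlgRandomness.Cantor) (P : AlgRandomness.PMeas),
      t ω P < ⊤ ↔ ∃ A : AlgRandomness.Cantor,
        AlgRandomness.MeasComputableIn A P ∧ AlgRandomness.MLRandom A P ω) ∧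
    (∀ R : AlgRandomness.Cantor → AlgRandomness.PMeas, AlgRandomness.IsRepresentation R →
      ∀ u : AlgRandomness.Cantor → AlgRandomness.Cantor → ℝ≥0∞,
        AlgRandomness.IsUniversalRTest R u →
        (∃ c : ℝ≥0, ∀ (ω : AlgRandomness.Cantor) (P : AlgRandomness.PMeas),
          t ω P ≤ c * ⨅ (π : AlgRandomness.Cantor) (_ : R π = P), u ω π) ∧
        (∃ c : ℝ≥0, ∀ (ω : AlgRandomness.Cantor) (P : AlgRandomness.PMeas),
          (⨅ (π : AlgRandomness.Cantor) (_ : R π = P), u ω π) ≤ c * t ω P)) := by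
  refine ⟨fun ω P => ⟨AlgRandomness.exists_oracle_of_lt_top ht, ?_⟩, fun R hR u hu => ⟨?_, ?_⟩⟩
  · rintro ⟨A, hA, hω⟩
    exact AlgRandomness.lt_top_of_mlRandom ht.1 hA hω
  · exact AlgRandomness.le_mul_iInf_of_isUniversalRTest hR ht.1 hu
  · exact ht.2 _ (AlgRandomness.isUniformTest_iInf_of_isRTest hR hu.1)
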